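/- For $A \subseteq \mathbb{N} = \{0,1,2,\dots\}$ let $\mathrm{Counting}(A)$ be the set of (encodings over $\{0,1\}$ of) Boolean circuits $c$ such that the number $\#(c)$ of input patterns on which $c$ evaluates to $1$ belongs to $A$. Let $\mathrm{UP}_{O(1)}$ be the class of languages $L \subseteq \{0,1\}^*$ for which there are a constant $k \in \mathbb{N}$, a function $f : \{0,1\}^* \to \mathbb{N}$, a polynomial $s$ and a set $R \in \mathrm{P}$ such that, for every $x \in \{0,1\}^*$: $f(x) \le k$; exactly $f(x)$ strings $y$ of length $s(|x|)$ satisfy $\langle x, y\rangle \in R$; and $x \in L$ if and only if $f(x) > 0$. **Corollary 3.** Let $A$ be a nonempty proper subset of $\mathbb{N}$. Then $\mathrm{Counting}(A)$ is $\mathrm{UP}_{O(1)}$-hard, that is, every $L \in \mathrm{UP}_{O(1)}$ is polynomial-time Turing reducible to $\mathrm{Counting}(A)$. Indeed, $\mathrm{Counting}(A)$ is $\mathrm{UP}_{O(1)}$-hard under polynomial-time 1-truth-table reductions: every $L \in \mathrm{UP}_{O(1)}$ satisfies $L \le^{p}_{1\text{-}tt} \mathrm{Counting}(A)$. -/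

import Mathlib

namespace CircuitCounting

open Turing StateTransition

/-! ### Languages, polynomial time -/

/-- Languages are sets of strings over the alphabet `{0,1}`. -/
abbrev Lang : Type := Set (List Bool)

/-- Functions on strings computed by a deterministic polynomial-time Turing machine. -/
def FP : Set (List Bool → List Bool) :=
  {f | Nonempty (TM2ComputableInPolyTime (id : List Bool → List Bool) id f)}

open Classical in
/-- Languages whose characteristic function is computed by a deterministic polynomial-time
Turing machine. -/
def P : Set Lang :=
  {L | Nonempty (TM2ComputableInPolyTime (id : List Bool → List Bool) (fun b : Bool => [b])
    (fun x => decide (x ∈ L)))}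

/-! ### Constant-ambiguity nondeterminism -/

/-- The pairing `⟨x, y⟩` on strings: the bits of `x` doubled, then `01`, then `y`. -/
def pair (x y : List Bool) : List Bool :=
  x.flatMap (fun b => [b, b]) ++ false :: true :: y

theorem pair_injective {x y x' y' : List Bool} (h : pair x y = pair x' y') :
    x = x' ∧ y = y' := by
  induction x generalizing x' with
  | nil => cases x' with
    | nil => simpa [pair] using h
    | cons b t => cases b <;> simp [pair] at h
  | cons a s ih => cases x' with
    | nil => cases a <;> simp [pair] at h
    | cons b t =>
      simp only [pair, List.flatMap_cons, List.cons_append, List.nil_append,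
        List.cons.injEq] at h
      obtain ⟨rfl, -, h⟩ := h
      obtain ⟨h1, h2⟩ := ih h
      exact ⟨by rw [h1], h2⟩

/-- The operator `#_g · C`. -/
def sharpBounded (g : ℕ → ℕ) (C : Set Lang) : Set (List Bool → ℕ) :=
  {f | ∃ L ∈ C, ∃ s : Polynomial ℕ, ∀ x : List Bool,
    f x ≤ g x.length ∧
    {y : List Bool | y.length = s.eval x.length ∧ pair x y ∈ L}.ncard = f x}

/-- The operator `#_const · C`. -/
def sharpConst (C : Set Lang) : Set (List Bool → ℕ) :=
  {f | ∃ k : ℕ, f ∈ sharpBounded (fun _ => k) C}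

/-- The class `UP_{O(1)}`. -/
def UPO1 : Set Lang :=
  {L | ∃ f ∈ sharpConst P, ∀ x, x ∈ L ↔ f x > 0}

/-! ### Polynomial-time reductions -/

/-- A deterministic oracle Turing machine: a multi-stack Turing machine with a query stack
and with a query label and two answer labels. -/
structure OracleTM where
  tm : FinTM2
  inputAlphabet : tm.Γ tm.k₀ ≃ Bool
  outputAlphabet : tm.Γ tm.k₁ ≃ Bool
  queryStack : tm.K
  queryAlphabet : tm.Γ queryStack ≃ Bool
  query : tm.Λ
  yes : tm.Λ
  no : tm.Λ

open Classical in
/-- One step with oracle `B`. At the query label the machine asks in one step whether the string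
on the query stack belongs to `B`: the query stack is erased and the computation goes on at the
label `yes` or `no`. At every other label the step is an ordinary one. -/
noncomputable def OracleTM.step (M : OracleTM) (B : Lang)
    (c : TM2.Cfg M.tm.Γ M.tm.Λ M.tm.σ) : Option (TM2.Cfg M.tm.Γ M.tm.Λ M.tm.σ) :=
  if c.l = some M.query then
    some
      { l := some (if (c.stk M.queryStack).map M.queryAlphabet ∈ B then M.yes else M.no)
        var := c.var
        stk := Function.update c.stk M.queryStack [] }
  else TM2.step M.tm.m c

open Classical in
/-- `M` with oracle `B` decides `L` in polynomial time: on every input it halts within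
polynomially many steps with the bit that says whether the input is in `L` as its output. -/
def OracleTM.DecidesInPolyTime (M : OracleTM) (B L : Lang) : Prop :=
  ∃ p : Polynomial ℕ, ∀ x : List Bool,
    Nonempty (EvalsToInTime (M.step B) (initList M.tm (x.map M.inputAlphabet.symm))
      (some (haltList M.tm [M.outputAlphabet.symm (decide (x ∈ L))])) (p.eval x.length))

/-- Polynomial-time Turing reducibility. -/
def TuringReduces (L B : Lang) : Prop :=
  ∃ M : OracleTM, M.DecidesInPolyTime B L

open Classical in
/-- Polynomial-time 1-truth-table reducibility: a polynomial-time generator `q` produces one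
query from the input, and a polynomial-time evaluator, given the answer bit and the input,
decides membership. -/
def OneTTReduces (L B : Lang) : Prop :=
  ∃ q ∈ FP, ∃ E ∈ P, ∀ x : List Bool, x ∈ L ↔ decide (q x ∈ B) :: x ∈ E

/-- `B` is `C`-hard (under polynomial-time Turing reductions). -/
def Hard (C : Set Lang) (B : Lang) : Prop :=
  ∀ L ∈ C, TuringReduces L B

/-- `B` is `C`-hard under polynomial-time 1-truth-table reductions. -/
def OneTTHard (C : Set Lang) (B : Lang) : Prop :=
  ∀ L ∈ C, OneTTReduces L B

/-! ### Boolean circuits -/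

/-- Boolean gates. The numbers are the wires that the gate reads. -/
inductive Gate
  | const (b : Bool)
  | neg (i : ℕ)
  | conj (i j : ℕ)
  | disj (i j : ℕ)

/-- The wires read by a gate. -/
def Gate.sources : Gate → List ℕ
  | const _ => []
  | neg i => [i]
  | conj i j => [i, j]
  | disj i j => [i, j]

/-- The value of a gate when the wires carry the values `w`. -/
def Gate.eval (w : List Bool) : Gate → Bool
  | const b => b
  | neg i => !(w.getD i false)
  | conj i j => w.getD i false && w.getD j false
  | disj i j => w.getD i false || w.getD j false

/-- Each gate reads only earlier wires, where `m` wires precede the first gate of the list. -/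
def WellFormed : ℕ → List Gate → Prop
  | _, [] => True
  | m, g :: gs => (∀ i ∈ g.sources, i < m) ∧ WellFormed (m + 1) gs

/-- The values of all wires after a list of gates, each of which adds one new wire. -/
def run : List Bool → List Gate → List Bool
  | w, [] => w
  | w, g :: gs => run (w ++ [g.eval w]) gs

/-- Boolean circuits: directed acyclic graphs of gates in topological order. Wires
`0, …, arity - 1` are the inputs, wire `arity + k` is the output of gate number `k`,
and one wire is designated as the output. -/
structure Circuit where
  arity : ℕ
  gates : List Gate
  output : ℕ
  wellFormed : WellFormed arity gates
  output_lt : output < arity + gates.length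

/-- The Boolean function represented by a circuit. -/
def Circuit.eval (c : Circuit) (x : Fin c.arity → Bool) : Bool :=
  (run (List.ofFn x) c.gates).getD c.output false

/-- `#(c)`: the number of input patterns under which `c` evaluates to `1`. -/
def Circuit.count (c : Circuit) : ℕ :=
  (Finset.univ.filter fun x : Fin c.arity → Bool => c.eval x = true).card

/-- Self-delimiting unary code `1ⁿ0`. As the wire numbers in a circuit are smaller than its number
of wires, it is polynomially related to the binary code. -/
def unary (n : ℕ) : List Bool :=
  List.replicate n true ++ [false]

/-- Code of a gate: a two-bit tag and the arguments. -/
def Gate.encode : Gate → List Bool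
  | const b => [false, false, b]
  | neg i => [false, true] ++ unary i
  | conj i j => [true, false] ++ unary i ++ unary j
  | disj i j => [true, true] ++ unary i ++ unary j

/-- Code of a list of gates: `1` before each gate, and `0` at the end. -/
def encodeGates : List Gate → List Bool
  | [] => [false]
  | g :: gs => true :: (g.encode ++ encodeGates gs)

/-- Code of a circuit. -/
def Circuit.encode (c : Circuit) : List Bool :=
  unary c.arity ++ encodeGates c.gates ++ unary c.output

theorem unary_append_inj {n m : ℕ} {s t : List Bool} (h : unary n ++ s = unary m ++ t) :
    n = m ∧ s = t := by
  induction n generalizing m with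
  | zero => cases m with
    | zero => simpa [unary] using h
    | succ m => simp [unary, List.replicate_succ] at h
  | succ n ih => cases m with
    | zero => simp [unary, List.replicate_succ] at h
    | succ m =>
      have h' : unary n ++ s = unary m ++ t := by
        simpa [unary, List.replicate_succ] using h
      obtain ⟨h1, h2⟩ := ih h'
      exact ⟨by rw [h1], h2⟩

theorem Gate.encode_append_inj {g g' : Gate} {s t : List Bool}
    (h : g.encode ++ s = g'.encode ++ t) : g = g' ∧ s = t := by
  cases g <;> cases g' <;>
    simp only [Gate.encode, List.cons_append, List.nil_append, List.append_assoc,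
      List.cons.injEq, Bool.false_eq_true, Bool.true_eq_false, false_and,
      true_and, and_false] at h
  · exact ⟨by rw [h.1], h.2⟩
  · obtain ⟨rfl, e⟩ := unary_append_inj h
    exact ⟨rfl, e⟩
  all_goals
    obtain ⟨rfl, e⟩ := unary_append_inj h
    obtain ⟨rfl, e⟩ := unary_append_inj e
    exact ⟨rfl, by assumption⟩

theorem encodeGates_append_inj {l l' : List Gate} {s t : List Bool}
    (h : encodeGates l ++ s = encodeGates l' ++ t) : l = l' ∧ s = t := by
  induction l generalizing l' with
  | nil => cases l' with
    | nil => simpa [encodeGates] using h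
    | cons g' l' => simp [encodeGates] at h
  | cons g l ih => cases l' with
    | nil => simp [encodeGates] at h
    | cons g' l' =>
      simp only [encodeGates, List.cons_append, List.append_assoc, List.cons.injEq,
        true_and] at h
      obtain ⟨rfl, e⟩ := Gate.encode_append_inj h
      obtain ⟨rfl, e'⟩ := ih e
      exact ⟨rfl, e'⟩

/-- Distinct circuits have distinct codes. -/
theorem Circuit.encode_injective : Function.Injective Circuit.encode := by
  rintro ⟨n, gs, o, h1, h2⟩ ⟨n', gs', o', h1', h2'⟩ h
  simp only [Circuit.encode, List.append_assoc] at h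
  obtain ⟨rfl, e⟩ := unary_append_inj h
  obtain ⟨rfl, e1⟩ := encodeGates_append_inj e
  have e2 : unary o ++ [] = unary o' ++ [] := by simpa using e1
  obtain ⟨rfl, -⟩ := unary_append_inj e2
  rfl

/-- The counting problem for `A`: the set of (codes of) circuits `c` with `#(c) ∈ A`. -/
def Counting (A : Set ℕ) : Lang :=
  {w | ∃ c : Circuit, c.encode = w ∧ c.count ∈ A}

end CircuitCounting

namespace CircuitCounting
open Turing StateTransition

/-! ### Runs of a partial transition function -/

/-! Let n = f(x) ≤ k be the number of witnesses of x. For fixed natural numbers c_0, …, c_k there is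
a circuit, computable from x in polynomial time, with exactly ∑ c_i·C(n,i) satisfying inputs: an
input consists of one of c_i tags of kind i and of k strings, of which the first i must be witnesses
in strictly increasing order and the others zero. It remains to choose the c_i so that this sum lies
on one side of A for n = 0 and on the other side for 1 ≤ n ≤ k. One of A and its complement is
infinite; call it B and take a outside B. Put c_0 = a. Since C(n,n) = 1 and later terms vanish at n,
and since B is unbounded, c_1, c_2, … can be chosen one after another so that c_n raises the value
at n to an element of B (`exists_coefficients`). Membership of x in L is then the answer to a single
query or its negation, which gives both kinds of reduction (`oneTTReduces_of_FP`,
`turingReduces_of_FP`).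

The main work is `exists_circuits`, a version of the Cook–Levin construction. A polynomial-time
machine is split into elementary steps that push or pop each stack at most once
(`exists_stackMachine`). If cell j of a row holds the entries at depth j of all stacks, pushes and
pops are shifts by one cell, so k runs on k candidate witnesses become one automaton on a row of
cells (`StackMachine.simulator_run`). The same row carries a fold over the bit columns that compares
the candidates (`StackMachine.simulator_fold`). The space-time tableau of this automaton is a
circuit (`Automaton.Formulas.eval_circuit`); it is deterministic and has no auxiliary inputs, so
satisfying inputs are counted exactly.

The tableau is regular: it consists of fixed blocks of gates whose wire numbers are arithmetic
expressions in loop counters. A small language of stack programs with loops over unary counters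
emits its code, and these programs compile to machines with a polynomial time bound (`Exec.runsIn`,
`Emits.mem_FP`, `Automaton.Formulas.encode_circuit_mem_FP`). -/

/-- `b` is reached from `a` within `n` steps of `f`. -/
def RunsIn {σ : Type*} (f : σ → Option σ) (n : ℕ) (a b : σ) : Prop :=
  ∃ t ≤ n, (flip bind f)^[t] (some a) = some b

namespace RunsIn

variable {σ : Type*} {f : σ → Option σ} {a b c : σ} {m n : ℕ}

theorem trans (h₁ : RunsIn f m a b) (h₂ : RunsIn f n b c) : RunsIn f (m + n) a c := by
  obtain ⟨s, hs, es⟩ := h₁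
  obtain ⟨t, ht, et⟩ := h₂
  refine ⟨t + s, by omega, ?_⟩
  rw [Function.iterate_add_apply, es, et]

theorem single (h : f a = some b) : RunsIn f 1 a b := ⟨1, le_rfl, h⟩

theorem head (h : f a = some b) (h₂ : RunsIn f n b c) : RunsIn f (1 + n) a c :=
  (single h).trans h₂

theorem mono (h : RunsIn f m a b) (hmn : m ≤ n) : RunsIn f n a b := by
  obtain ⟨s, hs, es⟩ := h
  exact ⟨s, hs.trans hmn, es⟩

theorem evalsToInTime (h : RunsIn f n a b) : Nonempty (EvalsToInTime f a (some b) n) := by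
  obtain ⟨s, hs, es⟩ := h
  exact ⟨⟨⟨s, es⟩, hs⟩⟩

theorem of_evalsToInTime (h : EvalsToInTime f a (some b) n) : RunsIn f n a b :=
  ⟨h.steps, h.steps_le_m, h.evals_in_steps⟩

end RunsIn

/-! ### A small language of stack programs -/

/-- Programs acting on stacks of bits that are named by natural numbers. The program `loop k p q`
pops stack `k` until it is empty and runs `p` after each `true` and `q` after each `false`. -/
inductive Prog
  | skip
  | push (k : ℕ) (b : Bool)
  | seq (p q : Prog)
  | loop (k : ℕ) (p q : Prog)

/-- The contents of all stacks. -/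
abbrev Stacks : Type := ℕ → List Bool

open Function in
/-- `p` takes the stacks `S` to `S'`, where no loop iterates more than `N` times and no loop body
changes the stack that controls the loop. -/
inductive Exec (N : ℕ) : Prog → Stacks → Stacks → Prop
  | skip (S) : Exec N .skip S S
  | push (k b S) : Exec N (.push k b) S (update S k (b :: S k))
  | seq {p q S S' S''} : Exec N p S S' → Exec N q S' S'' → Exec N (.seq p q) S S''
  | loop_nil {k p q S} : S k = [] → Exec N (.loop k p q) S S
  | loop_cons {k p q S S' S''} (b l) : S k = b :: l → (b :: l).length ≤ N →
      Exec N (bif b then p else q) (update S k l) S' → S' k = l →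
      Exec N (.loop k p q) S' S'' → Exec N (.loop k p q) S S''

theorem Exec.mono {N M : ℕ} (hNM : N ≤ M) {p : Prog} {S S' : Stacks} (h : Exec N p S S') :
    Exec M p S S' := by
  induction h with
  | skip S => exact .skip S
  | push k b S => exact .push k b S
  | seq _ _ h₁ h₂ => exact .seq h₁ h₂
  | loop_nil h => exact .loop_nil h
  | loop_cons b l e hl _ e' _ h₁ h₂ => exact .loop_cons b l e (hl.trans hNM) h₁ e' h₂

namespace Prog

/-- A bound for the running time of a program when no loop iterates more than `X` times. -/
noncomputable def cost : Prog → Polynomial ℕ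
  | skip => 1
  | push _ _ => 1
  | seq p q => p.cost + q.cost
  | loop _ p q => Polynomial.X * (p.cost + q.cost + 1) + 1

/-- A bound for the stack names in a program. -/
def names : Prog → ℕ
  | skip => 0
  | push k _ => k
  | seq p q => max p.names q.names
  | loop k p q => max k (max p.names q.names)

/-- The labels of the machine for a program. -/
def Lab : Prog → Type
  | skip => Unit
  | push _ _ => Unit
  | seq p q => p.Lab ⊕ q.Lab
  | loop _ p q => Option (p.Lab ⊕ q.Lab)

/-- There are finitely many labels. -/
@[reducible]
def labFintype : (p : Prog) → Fintype p.Lab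
  | skip => inferInstanceAs (Fintype Unit)
  | push _ _ => inferInstanceAs (Fintype Unit)
  | seq p q =>
    letI := p.labFintype
    letI := q.labFintype
    inferInstanceAs (Fintype (p.Lab ⊕ q.Lab))
  | loop _ p q =>
    letI := p.labFintype
    letI := q.labFintype
    inferInstanceAs (Fintype (Option (p.Lab ⊕ q.Lab)))

instance (p : Prog) : Fintype p.Lab := p.labFintype

/-- The first label. -/
def entry : (p : Prog) → p.Lab
  | skip => ()
  | push _ _ => ()
  | seq p _ => Sum.inl p.entry
  | loop _ _ _ => none

/-- The stack named `k` of a machine with `B + 1` stacks. -/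
def stackName (B k : ℕ) : Fin (B + 1) := Fin.ofNat (B + 1) k

/-- The statements of the machine for a program whose labels are embedded by `emb` and which
continues at `exit`. -/
def code {Λ : Type} (B : ℕ) : (p : Prog) → (p.Lab → Λ) → Λ → p.Lab →
    TM2.Stmt (fun _ : Fin (B + 1) => Bool) Λ (Option Bool)
  | skip, _, exit, _ => .goto fun _ => exit
  | push k b, _, exit, _ => .push (stackName B k) (fun _ => b) (.goto fun _ => exit)
  | seq p q, emb, exit, l =>
    Sum.elim (p.code B (fun l => emb (Sum.inl l)) (emb (Sum.inr q.entry)))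
      (q.code B (fun l => emb (Sum.inr l)) exit) l
  | loop k p q, emb, exit, l =>
    Option.elim l
      (.pop (stackName B k) (fun _ o => o) (.goto fun v => v.elim exit
        (fun b => bif b then emb (some (Sum.inl p.entry)) else emb (some (Sum.inr q.entry)))))
      (Sum.elim (p.code B (fun l => emb (some (Sum.inl l))) (emb none))
        (q.code B (fun l => emb (some (Sum.inr l))) (emb none)))

/-- The running time, with the number of iterations of an outermost loop taken exactly. -/
noncomputable def costAt (N : ℕ) (S : Stacks) : Prog → ℕ
  | loop k p q => (S k).length * ((p.cost + q.cost + 1).eval N) + 1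
  | skip => 1
  | push _ _ => 1
  | seq p q => (p.cost + q.cost).eval N

end Prog

theorem Exec.costAt_le {N : ℕ} {p : Prog} {S S' : Stacks} (h : Exec N p S S') :
    p.costAt N S ≤ p.cost.eval N := by
  cases h with
  | skip | push => simp [Prog.costAt, Prog.cost]
  | seq => exact le_rfl
  | loop_nil h => simp [Prog.costAt, Prog.cost, h]
  | loop_cons b l e hl _ _ _ =>
    simp only [Prog.costAt, Prog.cost, e, Polynomial.eval_add, Polynomial.eval_mul,
      Polynomial.eval_X, Polynomial.eval_one]
    gcongr

/-- The first `B + 1` stacks. -/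
def Stacks.restrict (B : ℕ) (S : Stacks) : Fin (B + 1) → List Bool := fun i => S i

theorem Prog.eq_stackName_iff {B k : ℕ} (hk : k ≤ B) (i : Fin (B + 1)) :
    i = Prog.stackName B k ↔ (i : ℕ) = k := by
  rw [Fin.ext_iff, Prog.stackName, Fin.val_ofNat, Nat.mod_eq_of_lt (by omega)]

theorem Stacks.restrict_update {B k : ℕ} (hk : k ≤ B) (S : Stacks) (l : List Bool) :
    Stacks.restrict B (Function.update S k l) =
      Function.update (S.restrict B) (Prog.stackName B k) l := by
  funext i
  rw [Stacks.restrict, Function.update_apply, Function.update_apply,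
    if_congr (Prog.eq_stackName_iff hk i).symm rfl rfl, Stacks.restrict]

theorem Stacks.restrict_apply {B k : ℕ} (hk : k ≤ B) (S : Stacks) :
    S.restrict B (Prog.stackName B k) = S k :=
  congrArg S ((Prog.eq_stackName_iff hk _).1 rfl)

/-- Induction on the execution, with the labels embedded in an arbitrary machine so that subprograms
are treated in place. The bound is `costAt` rather than `cost` because the rest of a loop must be
charged one iteration less. `Exec` makes this work: each body ends with the controlling stack as it
was after the pop. -/
theorem Exec.runsIn {Λ : Type} {N B : ℕ} {p : Prog} {S S' : Stacks} (h : Exec N p S S')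
    (M : Λ → TM2.Stmt (fun _ : Fin (B + 1) => Bool) Λ (Option Bool)) :
    ∀ (emb : p.Lab → Λ) (exit : Λ) (_ : ∀ l, M (emb l) = p.code B emb exit l)
      (_ : p.names ≤ B) (v : Option Bool),
      ∃ v', RunsIn (TM2.step M) (p.costAt N S) ⟨some (emb p.entry), v, S.restrict B⟩
        ⟨some exit, v', S'.restrict B⟩ := by
  induction h with
  | skip S =>
    intro emb exit hM _ v
    refine ⟨v, ?_⟩
    have := hM ()
    refine RunsIn.single ?_
    simp only [TM2.step, Prog.entry]
    erw [this]
    simp [Prog.code]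
  | push k b S =>
    intro emb exit hM hB v
    refine ⟨v, ?_⟩
    have := hM ()
    refine RunsIn.single ?_
    simp only [TM2.step, Prog.entry]
    erw [this]
    simp only [Prog.names] at hB
    simp [Prog.code, Stacks.restrict_update hB, Stacks.restrict_apply hB]
  | @seq p q S S' S'' h₁ h₂ ih₁ ih₂ =>
    intro emb exit hM hB v
    simp only [Prog.names, max_le_iff] at hB
    obtain ⟨v₁, r₁⟩ := ih₁ (fun l => emb (Sum.inl l)) (emb (Sum.inr q.entry))
      (fun l => hM (Sum.inl l)) hB.1 v
    obtain ⟨v₂, r₂⟩ := ih₂ (fun l => emb (Sum.inr l)) exit (fun l => hM (Sum.inr l)) hB.2 v₁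
    refine ⟨v₂, (r₁.trans r₂).mono ?_⟩
    have e₁ := h₁.costAt_le
    have e₂ := h₂.costAt_le
    calc _ ≤ p.cost.eval N + q.cost.eval N := add_le_add e₁ e₂
      _ = _ := Polynomial.eval_add.symm
  | @loop_nil k p q S h =>
    intro emb exit hM hB v
    refine ⟨none, ?_⟩
    have := hM none
    simp only [Prog.names, max_le_iff] at hB
    simp only [Prog.costAt, h, List.length_nil, zero_mul, zero_add]
    refine RunsIn.single ?_
    simp only [TM2.step, Prog.entry]
    erw [this]
    simp only [Prog.code, Option.elim_none, TM2.stepAux, Stacks.restrict_apply hB.1, h,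
      List.head?_nil, List.tail_nil]
    rw [← Stacks.restrict_update hB.1, ← h, Function.update_eq_self]
  | @loop_cons k p q S S' S'' b l e hl h₁ e' h₂ ih₁ ih₂ =>
    intro emb exit hM hB v
    have hn := hM none
    simp only [Prog.names, max_le_iff] at hB
    have key : ∃ v₁, RunsIn (TM2.step M) ((p.cost + q.cost).eval N)
        ⟨some (bif b then emb (some (Sum.inl p.entry)) else emb (some (Sum.inr q.entry))), some b,
          Stacks.restrict B (Function.update S k l)⟩ ⟨some (emb none), v₁, S'.restrict B⟩ := by
      have c := h₁.costAt_le
      cases b with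
      | true =>
        obtain ⟨v₁, r⟩ := ih₁ (fun l => emb (some (Sum.inl l))) (emb none)
          (fun l => hM (some (Sum.inl l))) hB.2.1 (some true)
        refine ⟨v₁, r.mono ?_⟩
        simp only [cond_true, Polynomial.eval_add] at c ⊢
        omega
      | false =>
        obtain ⟨v₁, r⟩ := ih₁ (fun l => emb (some (Sum.inr l))) (emb none)
          (fun l => hM (some (Sum.inr l))) hB.2.2 (some false)
        refine ⟨v₁, r.mono ?_⟩
        simp only [cond_false, Polynomial.eval_add] at c ⊢
        omega
    obtain ⟨v₁, r₁⟩ := key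
    obtain ⟨v₂, r₂⟩ := ih₂ emb exit hM (by simp [Prog.names, hB]) v₁
    refine ⟨v₂, ((RunsIn.head ?_ r₁).trans r₂).mono ?_⟩
    · simp only [TM2.step, Prog.entry]
      erw [hn]
      simp only [Prog.code, Option.elim_none, TM2.stepAux, Stacks.restrict_apply hB.1, e,
        List.head?_cons, List.tail_cons, Option.elim_some]
      rw [← Stacks.restrict_update hB.1]
    · simp only [Prog.costAt, e, e', List.length_cons, Polynomial.eval_add, Polynomial.eval_one]
      ring_nf
      omega

namespace Prog

/-- The machine that runs a program on the input on stack `1` and halts with its output on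
stack `0`. -/
def machine (p : Prog) : FinTM2 where
  -- One stack more than the names require, so that stack `1` exists even if `p` names only stack
  -- `0`.
  K := Fin (p.names + 1 + 1)
  k₀ := stackName (p.names + 1) 1
  k₁ := stackName (p.names + 1) 0
  Γ _ := Bool
  Λ := Option p.Lab
  main := some p.entry
  σ := Option Bool
  initialState := none
  -- `haltList` demands the initial internal state, so the exit label resets it before halting.
  m l := l.elim (.load (fun _ => none) .halt) (p.code (p.names + 1) some none)

/-- The stacks that hold `l` on stack `k` and nothing else. -/
def single (k : ℕ) (l : List Bool) : Stacks := Function.update (fun _ => []) k l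

theorem machine_runsIn (p : Prog) (B : Polynomial ℕ) (f : List Bool → List Bool)
    (h : ∀ x, Exec (B.eval x.length) p (single 1 x) (single 0 (f x))) (x : List Bool) :
    RunsIn p.machine.step (((p.cost + 1).comp B).eval x.length)
      (initList p.machine x) (haltList p.machine (f x)) := by
  obtain ⟨v, r⟩ := (h x).runsIn (B := p.names + 1) p.machine.m some none (fun l => rfl)
    (by omega) none
  have c := (h x).costAt_le
  have key : ∀ (k : ℕ) (_ : k ≤ p.names + 1) (l : List Bool) (i : Fin (p.names + 1 + 1)),
      (if i = stackName (p.names + 1) k then l else []) =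
        (single k l).restrict (p.names + 1) i := by
    intro k hk l i
    rw [single, Stacks.restrict_update hk, Function.update_apply]
    rfl
  have e₁ : initList p.machine x = ⟨some (some p.entry), none,
      (single 1 x).restrict (p.names + 1)⟩ :=
    congrArg (TM2.Cfg.mk _ _) (funext fun i => key 1 (by omega) x i)
  have e₂ : haltList p.machine (f x) = ⟨none, none,
      (single 0 (f x)).restrict (p.names + 1)⟩ :=
    congrArg (TM2.Cfg.mk _ _) (funext fun i => key 0 (by omega) (f x) i)
  rw [e₁, e₂]
  refine (r.trans (RunsIn.single (b := ⟨none, none, _⟩) ?_)).mono ?_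
  · rfl
  · simp only [Polynomial.eval_comp, Polynomial.eval_add, Polynomial.eval_one]
    omega

theorem computableInPolyTime {β : Type} {eb : β → List Bool} (p : Prog) (B : Polynomial ℕ)
    (f : List Bool → β)
    (h : ∀ x, Exec (B.eval x.length) p (single 1 x) (single 0 (eb (f x)))) :
    Nonempty (TM2ComputableInPolyTime (id : List Bool → List Bool) eb f) :=
  ⟨{ tm := p.machine
     inputAlphabet := Equiv.refl _
     outputAlphabet := Equiv.refl _
     time := (p.cost + 1).comp B
     outputsFun := fun x => by
      have := (machine_runsIn p B (fun x => eb (f x)) h x).evalsToInTime.some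
      refine cast ?_ this
      simp only [TM2OutputsInTime, Option.map_some, id_eq]
      congr 2
      · exact (List.map_id _).symm
      · exact congrArg (haltList p.machine) (List.map_id _).symm }⟩

end Prog
end CircuitCounting

namespace CircuitCounting
open Turing StateTransition
open Function (update)

/-! ### Emission of strings by stack programs -/

/-- The stacks with an output string, an input string, an auxiliary string and unary counters. -/
def Stacks.mk (out x tmp : List Bool) (env : ℕ → ℕ) : Stacks
  | 0 => out
  | 1 => x
  | 2 => tmp
  | i + 3 => List.replicate (env i) true

namespace Stacks

variable (out x tmp l : List Bool) (env : ℕ → ℕ)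

@[simp] theorem mk_zero : mk out x tmp env 0 = out := rfl
@[simp] theorem mk_one : mk out x tmp env 1 = x := rfl
@[simp] theorem mk_two : mk out x tmp env 2 = tmp := rfl
@[simp] theorem mk_add (i : ℕ) : mk out x tmp env (i + 3) = List.replicate (env i) true := rfl

@[simp] theorem update_mk_zero : update (mk out x tmp env) 0 l = mk l x tmp env := by
  funext i
  rcases i with _ | _ | _ | i <;> simp

@[simp] theorem update_mk_one : update (mk out x tmp env) 1 l = mk out l tmp env := by
  funext i
  rcases i with _ | _ | _ | i <;> simp

@[simp] theorem update_mk_two : update (mk out x tmp env) 2 l = mk out x l env := by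
  funext i
  rcases i with _ | _ | _ | i <;> simp

@[simp] theorem update_mk_add (i c : ℕ) :
    update (mk out x tmp env) (i + 3) (List.replicate c true) = mk out x tmp (update env i c) := by
  funext j
  rcases j with _ | _ | _ | j <;> simp [Function.update_apply]
  split_ifs <;> rfl

end Stacks

theorem Exec.push_counter {N : ℕ} (i : ℕ) (out x tmp : List Bool) (env : ℕ → ℕ) :
    Exec N (.push (i + 3) true) (.mk out x tmp env)
      (.mk out x tmp (update env i (env i + 1))) := by
  have := Exec.push (N := N) (i + 3) true (.mk out x tmp env)
  rwa [Stacks.mk_add, ← List.replicate_succ, Stacks.update_mk_add] at this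

theorem Exec.loop_counter_succ {N i c : ℕ} {p q : Prog} {out x tmp : List Bool} {env : ℕ → ℕ}
    {out' x' tmp' : List Bool} {env' : ℕ → ℕ} {S : Stacks} (hc : env i = c + 1) (hN : c + 1 ≤ N)
    (h : Exec N p (.mk out x tmp (update env i c)) (.mk out' x' tmp' env')) (hc' : env' i = c)
    (h' : Exec N (.loop (i + 3) p q) (.mk out' x' tmp' env') S) :
    Exec N (.loop (i + 3) p q) (.mk out x tmp env) S :=
  .loop_cons true (List.replicate c true) (by simp [hc, List.replicate_succ]) (by simpa)
    (by simpa using h) (by simp [hc']) h'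

theorem Exec.loop_counter_zero {N i : ℕ} {p q : Prog} {out x tmp : List Bool} {env : ℕ → ℕ}
    (hc : env i = 0) :
    Exec N (.loop (i + 3) p q) (.mk out x tmp env) (.mk out x tmp env) :=
  .loop_nil (by simp [hc])

theorem update_eq_self_of {env : ℕ → ℕ} {i c : ℕ} (h : env i = c) : update env i c = env := by
  rw [← h, Function.update_eq_self]

theorem Exec.counter_to_tmp {N i : ℕ} (out x : List Bool) : ∀ (c : ℕ) (tmp : List Bool)
    (env : ℕ → ℕ), env i = c → c ≤ N → Exec N (.loop (i + 3) (.push 2 true) .skip)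
      (.mk out x tmp env) (.mk out x (List.replicate c true ++ tmp) (update env i 0))
  | 0, tmp, env, hc, _ => by
    have := Exec.loop_counter_zero (N := N) (p := .push 2 true) (q := .skip) (out := out) (x := x)
      (tmp := tmp) hc
    simpa [update_eq_self_of hc] using this
  | c + 1, tmp, env, hc, hN => by
    refine Exec.loop_counter_succ hc hN (env' := update env i c) (tmp' := true :: tmp)
      (by simpa using Exec.push 2 true (.mk out x tmp (update env i c))) (by simp) ?_
    have := Exec.counter_to_tmp (N := N) (i := i) out x c (true :: tmp) (update env i c) (by simp) (by omega)
    simpa [List.replicate_succ', List.append_assoc] using this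

/-- Looping over a counter destroys it. A counter is therefore copied by moving it to the auxiliary
stack and from there into both source and target. -/
theorem Exec.tmp_to_counters {N i t : ℕ} (hit : i ≠ t) (out x : List Bool) : ∀ (c : ℕ)
    (env : ℕ → ℕ), c ≤ N →
    Exec N (.loop 2 (.seq (.push (i + 3) true) (.push (t + 3) true)) .skip)
      (.mk out x (List.replicate c true) env)
      (.mk out x [] (update (update env i (env i + c)) t (env t + c)))
  | 0, env, _ => by simpa using Exec.loop_nil (by simp)
  | c + 1, env, hN => by
    have h1 := Exec.push_counter (N := N) i out x (List.replicate c true) env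
    have h2 := Exec.push_counter (N := N) t out x (List.replicate c true)
      (update env i (env i + 1))
    rw [Function.update_of_ne hit.symm] at h2
    refine .loop_cons true (List.replicate c true) (by simp [List.replicate_succ]) (by simpa)
      (by simpa using h1.seq h2) (by simp) ?_
    have := Exec.tmp_to_counters (N := N) hit out x c
      (update (update env i (env i + 1)) t (env t + 1)) (by omega)
    convert this using 2
    funext j
    by_cases hj : j = t
    · subst hj; simp; omega
    · by_cases hi : j = i
      · subst hi; simp [hj]; omega
      · simp [hj, hi]

/-- An invariant for loops in which everything is determined by what is left on the controlling
stack, such as the clearing of a stack. -/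
theorem Exec.loop_list {N k : ℕ} {p q : Prog} (T : List Bool → Stacks)
    (hT : ∀ l, T l k = l)
    (h : ∀ b l, Exec N (bif b then p else q) (update (T (b :: l)) k l) (T l)) :
    ∀ l, l.length ≤ N → Exec N (.loop k p q) (T l) (T [])
  | [], _ => .loop_nil (hT _)
  | b :: l, hl => .loop_cons b l (hT _) hl (h b l) (hT l)
      (Exec.loop_list T hT h l (by simp at hl; omega))

/-- Push a string, so that its first bit becomes the top. -/
def Prog.pushes (k : ℕ) : List Bool → Prog
  | [] => .skip
  | b :: l => .seq (Prog.pushes k l) (.push k b)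

theorem Exec.pushes_zero {N : ℕ} (l out x tmp : List Bool) (env : ℕ → ℕ) :
    Exec N (.pushes 0 l) (.mk out x tmp env) (.mk (l ++ out) x tmp env) := by
  induction l with
  | nil => exact .skip _
  | cons b l ih => exact .seq ih (by simpa using Exec.push 0 b (.mk (l ++ out) x tmp env))

/-- Arithmetic expressions in counters. -/
inductive Expr
  | const (c : ℕ)
  | var (i : ℕ)
  | add (a b : Expr)
  | mul (a b : Expr)

namespace Expr

/-- The value of an expression. -/
def eval (env : ℕ → ℕ) : Expr → ℕ
  | const c => c
  | var i => env i
  | add a b => a.eval env + b.eval env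
  | mul a b => a.eval env * b.eval env

/-- All variables are below `d`. -/
def Scoped (d : ℕ) : Expr → Prop
  | const _ => True
  | var i => i < d
  | add a b => a.Scoped d ∧ b.Scoped d
  | mul a b => a.Scoped d ∧ b.Scoped d

theorem eval_congr {d : ℕ} {env env' : ℕ → ℕ} (h : ∀ i < d, env i = env' i) :
    ∀ e : Expr, e.Scoped d → e.eval env = e.eval env'
  | const _, _ => rfl
  | var i, hi => h i hi
  | add a b, hs => by simp only [eval, eval_congr h a hs.1, eval_congr h b hs.2]
  | mul a b, hs => by simp only [eval, eval_congr h a hs.1, eval_congr h b hs.2]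

/-- A bound for the values of all subexpressions when the counters are at most `X`. -/
noncomputable def bound : Expr → Polynomial ℕ
  | const c => Polynomial.C c
  | var _ => Polynomial.X
  | add a b => a.bound + b.bound
  -- The additional summands keep the bound above those of both factors, whose own loops may run
  -- even if the product is zero.
  | mul a b => a.bound * b.bound + a.bound + b.bound

theorem eval_le {d N : ℕ} {env : ℕ → ℕ} (h : ∀ i < d, env i ≤ N) :
    ∀ e : Expr, e.Scoped d → e.eval env ≤ e.bound.eval N
  | const c, _ => by simp [eval, bound]
  | var i, hi => by simpa [eval, bound] using h i hi
  | add a b, hs => by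
    simpa [eval, bound] using add_le_add (eval_le h a hs.1) (eval_le h b hs.2)
  | mul a b, hs => by
    have := Nat.mul_le_mul (eval_le h a hs.1) (eval_le h b hs.2)
    simp only [eval, bound, Polynomial.eval_add, Polynomial.eval_mul]
    omega

/-- A program that adds the value of an expression to counter `t`, with counters from `s` on as
auxiliary counters. -/
def prog (t : ℕ) : Expr → ℕ → Prog
  | const c, _ => .pushes (t + 3) (List.replicate c true)
  | var i, _ => .seq (.loop (i + 3) (.push 2 true) .skip)
      (.loop 2 (.seq (.push (i + 3) true) (.push (t + 3) true)) .skip)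
  | add a b, s => .seq (a.prog t s) (b.prog t s)
  | mul a b, s => .seq (a.prog s (s + 1)) (.loop (s + 3) (b.prog t (s + 1)) .skip)

/-- Variables lie below `d`, the target `t` does not, and the counters from `s` on are scratch space
that is zero before and after. So adding to `t` never changes the value of a subexpression evaluated
later. For a product the first factor is put into counter `s`, which then controls repeated addition
of the second. -/
theorem exec_prog {d N : ℕ} (out x : List Bool) : ∀ (e : Expr) (t s : ℕ) (env : ℕ → ℕ),
    (∀ i < d, env i ≤ N) → e.Scoped d → d ≤ t → t < s → (∀ i ≥ s, env i = 0) →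
    Exec (e.bound.eval N) (e.prog t s) (.mk out x [] env)
      (.mk out x [] (update env t (env t + e.eval env)))
  | const c, t, s, env, _, _, _, _, _ => by
    simp only [prog, eval]
    generalize (const c).bound.eval N = M
    clear * -
    induction c with
    | zero => simpa [Prog.pushes] using Exec.skip _
    | succ c ih =>
      refine .seq ih ?_
      have := Exec.push_counter (N := M) t out x [] (update env t (env t + c))
      simpa [add_assoc] using this
  | var i, t, s, env, hN, hi, hd, _, _ => by
    have hi : i < d := hi
    have hit : i ≠ t := by omega
    simp only [prog, eval, bound, Polynomial.eval_X]
    refine .seq (S' := .mk out x (List.replicate (env i) true) (update env i 0)) ?_ ?_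
    · simpa using Exec.counter_to_tmp out x (env i) [] env rfl (hN i hi)
    · have := Exec.tmp_to_counters hit out x (env i) (update env i 0) (hN i hi)
      simpa [Function.update_of_ne hit.symm] using this
  | add a b, t, s, env, hN, hs, hd, hts, h0 => by
    simp only [prog, eval, bound, Polynomial.eval_add]
    refine .seq ((exec_prog out x a t s env hN hs.1 hd hts h0).mono (by omega)) ?_
    have := exec_prog (d := d) (N := N) out x b t s (update env t (env t + a.eval env))
      (fun i hi => by rw [Function.update_of_ne (by omega)]; exact hN i hi) hs.2 hd hts
      (fun i hi => by rw [Function.update_of_ne (by omega)]; exact h0 i hi)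
    have e : b.eval (update env t (env t + a.eval env)) = b.eval env :=
      eval_congr (fun i hi => Function.update_of_ne (by omega) _ _) b hs.2
    rw [e, Function.update_self, Function.update_idem, add_assoc] at this
    exact this.mono (by omega)
  | mul a b, t, s, env, hN, hs, hd, hts, h0 => by
    simp only [prog, eval, bound, Polynomial.eval_add, Polynomial.eval_mul]
    have h1 := exec_prog (d := d) (N := N) out x a s (s + 1) env hN hs.1 (by omega) (by omega)
      (fun i hi => h0 i (by omega))
    rw [h0 s le_rfl, zero_add] at h1
    refine .seq (h1.mono (by omega)) ?_
    have hc := eval_le hN a hs.1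
    generalize a.eval env = c at hc ⊢
    have hb := eval_le hN b hs.2
    clear h1
    induction c generalizing env with
    | zero =>
      have := Exec.loop_counter_zero (N := a.bound.eval N * b.bound.eval N + a.bound.eval N +
        b.bound.eval N) (i := s) (p := b.prog t (s + 1)) (q := .skip) (out := out) (x := x)
        (tmp := []) (env := update env s 0) (by simp)
      have e : update env s 0 = env := update_eq_self_of (h0 s le_rfl)
      simpa [e] using this
    | succ c ih =>
      have h2 := exec_prog (d := d) (N := N) out x b t (s + 1) (update env s c)
        (fun i hi => by rw [Function.update_of_ne (by omega)]; exact hN i hi) hs.2 hd (by omega)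
        (fun i hi => by rw [Function.update_of_ne (by omega)]; exact h0 i (by omega))
      have e : b.eval (update env s c) = b.eval env :=
        eval_congr (fun i hi => Function.update_of_ne (by omega) _ _) b hs.2
      rw [e, Function.update_of_ne (by omega : t ≠ s)] at h2
      refine Exec.loop_counter_succ (c := c) (by simp) (by omega)
        (by rw [Function.update_idem]; exact h2.mono (by omega))
        (by rw [Function.update_of_ne (by omega)]; simp) ?_
      have e' : b.eval (update env t (env t + b.eval env)) = b.eval env :=
        eval_congr (fun i hi => Function.update_of_ne (by omega) _ _) b hs.2
      have := ih (update env t (env t + b.eval env))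
        (fun i hi => by rw [Function.update_of_ne (by omega)]; exact hN i hi)
        (fun i hi => by rw [Function.update_of_ne (by omega)]; exact h0 i hi) (by omega)
        (by rw [e']; exact hb)
      rw [e', Function.update_self, Function.update_idem] at this
      rw [Function.update_comm (by omega : s ≠ t), Nat.succ_mul]
      convert this using 3
      ring

end Expr

/-- Functions of the first `d` counters that are given by an expression. -/
def IsExpr (d : ℕ) (f : (ℕ → ℕ) → ℕ) : Prop :=
  ∃ e : Expr, e.Scoped d ∧ ∀ env, e.eval env = f env

namespace IsExpr

variable {d : ℕ} {f g : (ℕ → ℕ) → ℕ}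

theorem const (c : ℕ) : IsExpr d fun _ => c := ⟨.const c, trivial, fun _ => rfl⟩

theorem var {i : ℕ} (hi : i < d) : IsExpr d fun env => env i := ⟨.var i, hi, fun _ => rfl⟩

theorem add (hf : IsExpr d f) (hg : IsExpr d g) : IsExpr d fun env => f env + g env := by
  obtain ⟨a, ha, ea⟩ := hf
  obtain ⟨b, hb, eb⟩ := hg
  exact ⟨.add a b, ⟨ha, hb⟩, fun env => by rw [Expr.eval, ea, eb]⟩

theorem mul (hf : IsExpr d f) (hg : IsExpr d g) : IsExpr d fun env => f env * g env := by
  obtain ⟨a, ha, ea⟩ := hf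
  obtain ⟨b, hb, eb⟩ := hg
  exact ⟨.mul a b, ⟨ha, hb⟩, fun env => by rw [Expr.eval, ea, eb]⟩

theorem pow (hf : IsExpr d f) (n : ℕ) : IsExpr d fun env => f env ^ n := by
  induction n with
  | zero => simpa using const 1
  | succ n ih => simpa [pow_succ] using ih.mul hf

theorem polynomial (hf : IsExpr d f) (P : Polynomial ℕ) : IsExpr d fun env => P.eval (f env) := by
  induction P using Polynomial.induction_on' with
  | add p q hp hq => simpa using hp.add hq
  | monomial n c => simpa using (const c).mul (hf.pow n)

end IsExpr

/-- The string `w x env` that depends on the string `x` and on the first `d` counters can be emitted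
by a program in polynomial time. -/
def Emits (d : ℕ) (w : List Bool → (ℕ → ℕ) → List Bool) : Prop :=
  ∃ (p : Prog) (B : Polynomial ℕ), ∀ (x : List Bool) (env : ℕ → ℕ) (N : ℕ) (out : List Bool),
    (∀ i ≥ d, env i = 0) → (∀ i, env i ≤ N) → x.length ≤ N →
    (w x env).length ≤ B.eval N ∧
      Exec (B.eval N) p (.mk out x [] env) (.mk (w x env ++ out) x [] env)

namespace Emits

variable {d : ℕ} {w w' : List Bool → (ℕ → ℕ) → List Bool}

theorem lit (l : List Bool) : Emits d fun _ _ => l :=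
  ⟨.pushes 0 l, Polynomial.C l.length, fun x env N out _ _ _ =>
    ⟨by simp, Exec.pushes_zero l out x [] env⟩⟩

theorem append (h : Emits d w) (h' : Emits d w') : Emits d fun x env => w x env ++ w' x env := by
  obtain ⟨p, B, hp⟩ := h
  obtain ⟨p', B', hp'⟩ := h'
  -- The output is a stack and is written from its end, so the second string is emitted first.
  refine ⟨.seq p' p, B + B', fun x env N out h0 hN hx => ?_⟩
  have h1 := hp x env N (w' x env ++ out) h0 hN hx
  have h2 := hp' x env N out h0 hN hx
  simp only [Polynomial.eval_add, List.length_append, List.append_assoc]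
  exact ⟨add_le_add h1.1 h2.1, .seq (h2.2.mono (by omega)) (h1.2.mono (by omega))⟩

/-- The counter that controls the loop is also the loop variable: after the pops it holds c - 1, …,
0. As output is prepended, this descending order produces the pieces in ascending order, and the
counter ends at zero. -/
theorem loop {f : (ℕ → ℕ) → ℕ} (hf : IsExpr d f) (h : Emits (d + 1) w) :
    Emits d fun x env => (List.range (f env)).flatMap fun i => w x (update env d i) := by
  obtain ⟨e, hs, he⟩ := hf
  obtain ⟨p, B, hp⟩ := h
  refine ⟨.seq (e.prog d (d + 1)) (.loop (d + 3) p .skip),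
    e.bound + e.bound * B.comp (Polynomial.X + e.bound) + B.comp (Polynomial.X + e.bound),
    fun x env N out h0 hN hx => ?_⟩
  have hle := e.eval_le (fun i _ => hN i) hs
  have h1 := e.exec_prog (d := d) (N := N) out x d (d + 1) env (fun i _ => hN i) hs le_rfl (by omega)
    (fun i hi => h0 i (by omega))
  rw [h0 d le_rfl, zero_add, he] at h1
  rw [he] at hle
  simp only [Polynomial.eval_add, Polynomial.eval_mul, Polynomial.eval_comp, Polynomial.eval_X]
  generalize e.bound.eval N = E at *
  generalize f env = c at *
  have key : ∀ c ≤ E, ((List.range c).flatMap fun i => w x (update env d i)).length ≤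
      c * B.eval (N + E) ∧ ∀ out, Exec (E + E * B.eval (N + E) + B.eval (N + E))
        (.loop (d + 3) p .skip) (.mk out x [] (update env d c))
        (.mk (((List.range c).flatMap fun i => w x (update env d i)) ++ out) x [] env) := by
    intro c
    induction c with
    | zero =>
      intro _
      refine ⟨by simp, fun out => ?_⟩
      have e : update env d 0 = env := update_eq_self_of (h0 d le_rfl)
      simpa [e] using Exec.loop_counter_zero (h0 d le_rfl)
    | succ c ih =>
      intro hc
      obtain ⟨ih1, ih2⟩ := ih (by omega)
      have h2 := fun out => hp x (update env d c) (N + E) out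
        (fun i hi => by rw [Function.update_of_ne (by omega)]; exact h0 i (by omega))
        (fun i => by
          by_cases hi : i = d
          · subst hi; simp; omega
          · rw [Function.update_of_ne hi]; have := hN i; omega) (by omega)
      constructor
      · rw [List.range_succ, List.flatMap_append, List.length_append, Nat.succ_mul]
        simpa using add_le_add ih1 (h2 out).1
      · intro out
        refine Exec.loop_counter_succ (c := c) (by simp) (by omega)
          (by rw [Function.update_idem]; exact (h2 out).2.mono (by omega)) (by simp) ?_
        have := ih2 (w x (update env d c) ++ out)
        simpa [List.range_succ, List.flatMap_append] using this
  obtain ⟨k1, k2⟩ := key c hle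
  refine ⟨k1.trans ?_, .seq (h1.mono (by omega)) (k2 out)⟩
  have := Nat.mul_le_mul_right (B.eval (N + E)) hle
  omega

/-- The input is first reversed onto the auxiliary stack. Emptying that stack restores the input and
meets its bits from last to first, which is the right order for prepending their images. -/
theorem bits (h : Bool → List Bool) : Emits d fun x _ => x.flatMap h := by
  refine ⟨.seq (.loop 1 (.push 2 true) (.push 2 false))
    (.loop 2 (.seq (.push 1 true) (.pushes 0 (h true)))
      (.seq (.push 1 false) (.pushes 0 (h false)))),
    Polynomial.X * Polynomial.C ((h true).length + (h false).length + 1),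
    fun x env N out h0 hN hx => ⟨?_, ?_⟩⟩
  · simp only [Polynomial.eval_mul, Polynomial.eval_X, Polynomial.eval_C]
    refine le_trans ?_ (Nat.mul_le_mul_right _ hx)
    clear hx
    induction x with
    | nil => simp
    | cons b x ih =>
      rw [List.flatMap_cons, List.length_append, List.length_cons, Nat.succ_mul]
      cases b <;> omega
  · have hM : x.length ≤ (Polynomial.X * Polynomial.C ((h true).length + (h false).length + 1) :
        Polynomial ℕ).eval N := by
      simp only [Polynomial.eval_mul, Polynomial.eval_X, Polynomial.eval_C]
      nlinarith
    generalize (Polynomial.X * Polynomial.C ((h true).length + (h false).length + 1) :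
        Polynomial ℕ).eval N = M at hM
    refine .seq (S' := .mk out [] x.reverse env) ?_ ?_
    · have : ∀ x tmp : List Bool, x.length ≤ M → Exec M (.loop 1 (.push 2 true) (.push 2 false))
          (.mk out x tmp env) (.mk out [] (x.reverse ++ tmp) env) := by
        intro x
        induction x with
        | nil => exact fun tmp _ => .loop_nil rfl
        | cons b x ih =>
          intro tmp hM
          have := ih (b :: tmp) (by simp at hM; omega)
          refine .loop_cons (S' := .mk out x (b :: tmp) env) b x rfl hM ?_ rfl (by simpa using this)
          cases b
          · simpa using Exec.push 2 false (.mk out x tmp env)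
          · simpa using Exec.push 2 true (.mk out x tmp env)
      simpa using this x [] hM
    · rw [← List.length_reverse] at hM
      have : ∀ l y out : List Bool, l.length ≤ M → Exec M
          (.loop 2 (.seq (.push 1 true) (.pushes 0 (h true)))
            (.seq (.push 1 false) (.pushes 0 (h false))))
          (.mk out y l env) (.mk (l.reverse.flatMap h ++ out) (l.reverse ++ y) [] env) := by
        intro l
        induction l with
        | nil => exact fun y out _ => .loop_nil rfl
        | cons b l ih =>
          intro y out hM
          have := ih (b :: y) (h b ++ out) (by simp at hM; omega)
          refine .loop_cons (S' := .mk (h b ++ out) (b :: y) l env) b l rfl hM ?_ rfl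
            (by simpa using this)
          cases b
          · have := Exec.push (N := M) 1 false (.mk out y l env)
            simp only [Stacks.mk_one, Stacks.update_mk_one] at this
            simpa using this.seq (Exec.pushes_zero (h false) out (false :: y) l env)
          · have := Exec.push (N := M) 1 true (.mk out y l env)
            simp only [Stacks.mk_one, Stacks.update_mk_one] at this
            simpa using this.seq (Exec.pushes_zero (h true) out (true :: y) l env)
      simpa using this x.reverse [] out hM

/-- A pass over the input and back sets counter `0` to its length. After the emission the input and
this counter are cleared, since a halting machine must leave nothing but its output. -/
theorem mem_FP {w : List Bool → (ℕ → ℕ) → List Bool} (h : Emits 1 w) :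
    (fun x => w x (update 0 0 x.length)) ∈ FP := by
  obtain ⟨p, B, hp⟩ := h
  refine Prog.computableInPolyTime
    (.seq (.loop 1 (.seq (.push 2 true) (.push 3 true)) (.seq (.push 2 false) (.push 3 true)))
      (.seq (.loop 2 (.push 1 true) (.push 1 false))
        (.seq p (.seq (.loop 1 .skip .skip) (.loop 3 .skip .skip)))))
    (B + Polynomial.X) _ fun x => ?_
  simp only [Polynomial.eval_add, Polynomial.eval_X]
  have e1 : Prog.single 1 x = .mk [] x [] 0 := by
    funext i
    rcases i with _ | _ | _ | i <;> simp [Prog.single]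
  have e2 : ∀ l, Prog.single 0 l = .mk l [] [] 0 := by
    intro l
    funext i
    rcases i with _ | _ | _ | i <;> simp [Prog.single]
  have h2 := (hp x (update 0 0 x.length) x.length []
    (fun i hi => by rw [Function.update_of_ne (by omega)]; rfl)
    (fun i => by by_cases hi : i = 0 <;> simp [hi]) le_rfl).2
  rw [List.append_nil] at h2
  have hM : x.length ≤ B.eval x.length + x.length := Nat.le_add_left _ _
  have h2 := h2.mono (Nat.le_add_right _ x.length)
  rw [e1, e2]
  simp only [id]
  generalize B.eval x.length + x.length = M at *
  refine .seq (S' := .mk [] [] x.reverse (update 0 0 x.length)) ?_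
    (.seq (S' := .mk [] x [] (update 0 0 x.length)) ?_ (.seq h2
      (.seq (S' := .mk (w x (update 0 0 x.length)) [] [] (update 0 0 x.length)) ?_ ?_)))
  · have : ∀ (x tmp : List Bool) (env : ℕ → ℕ), x.length ≤ M →
        Exec M (.loop 1 (.seq (.push 2 true) (.push 3 true)) (.seq (.push 2 false) (.push 3 true)))
          (.mk [] x tmp env) (.mk [] [] (x.reverse ++ tmp) (update env 0 (env 0 + x.length))) := by
      intro x
      induction x with
      | nil => intro tmp env _; simpa using Exec.loop_nil rfl
      | cons b x ih =>
        intro tmp env hM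
        have := ih (b :: tmp) (update env 0 (env 0 + 1)) (by simp at hM; omega)
        refine .loop_cons (S' := .mk [] x (b :: tmp) (update env 0 (env 0 + 1))) b x rfl hM ?_ rfl
          (by simpa [add_assoc, add_comm 1] using this)
        have h1 := Exec.push (N := M) 2 b (.mk [] x tmp env)
        simp only [Stacks.mk_two, Stacks.update_mk_two] at h1
        have := h1.seq (Exec.push_counter 0 [] x (b :: tmp) env)
        cases b <;> simpa using this
    simpa using this x [] 0 hM
  · rw [← List.length_reverse] at hM
    have : ∀ (l y : List Bool) (env : ℕ → ℕ), l.length ≤ M →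
        Exec M (.loop 2 (.push 1 true) (.push 1 false))
          (.mk [] y l env) (.mk [] (l.reverse ++ y) [] env) := by
      intro l
      induction l with
      | nil => exact fun y env _ => .loop_nil rfl
      | cons b l ih =>
        intro y env hM
        have := ih (b :: y) env (by simp at hM; omega)
        refine .loop_cons (S' := .mk [] (b :: y) l env) b l rfl hM ?_ rfl (by simpa using this)
        have h1 := Exec.push (N := M) 1 b (.mk [] y l env)
        cases b <;> simpa using h1
    simpa using this x.reverse [] (update 0 0 x.length) hM
  · exact Exec.loop_list (fun l => .mk (w x (update 0 0 x.length)) l [] (update 0 0 x.length)) (fun _ => rfl)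
      (fun b l => by cases b <;> simpa using Exec.skip _) x hM
  · have : ∀ (c : ℕ) (env : ℕ → ℕ) (out : List Bool), env 0 = c → c ≤ M →
        Exec M (.loop 3 .skip .skip) (.mk out [] [] env) (.mk out [] [] (update env 0 0)) := by
      intro c
      induction c with
      | zero =>
        intro env out hc _
        have := Exec.loop_counter_zero (N := M) (p := .skip) (q := .skip) (out := out) (x := [])
          (tmp := []) hc
        simpa [update_eq_self_of hc] using this
      | succ c ih =>
        intro env out hc hM
        refine Exec.loop_counter_succ (i := 0) hc hM (.skip _) (by simp) ?_
        simpa using ih (update env 0 c) out (by simp) (by omega)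
    have e : update (update (0 : ℕ → ℕ) 0 x.length) 0 0 = 0 := by simp
    have := this x.length (update 0 0 x.length) (w x (update 0 0 x.length)) (by simp) hM
    rwa [e] at this

end Emits
end CircuitCounting

namespace CircuitCounting
open Turing StateTransition
open Function (update)

/-! ### Reductions with a single query -/

open Classical in
/-- The strings with first bit `b` form a language in `P`. -/
theorem head_mem_P (b : Bool) : {w : List Bool | w.head? = some b} ∈ P := by
  let q (a : Bool) : Prog := .seq (.loop 0 .skip .skip) (.push 0 a)
  have hq : ∀ (N : ℕ) (a : Bool) (x tmp : List Bool) (c : Bool), 1 ≤ N →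
      Exec N (q a) (.mk [c] x tmp 0) (.mk [a] x tmp 0) := by
    intro N a x tmp c hN
    refine .seq (S' := .mk [] x tmp 0) ?_ (by simpa using Exec.push 0 a (.mk [] x tmp 0))
    exact Exec.loop_list (fun l => .mk l x tmp 0) (fun _ => rfl)
      (fun b l => by cases b <;> simpa using Exec.skip _) [c] (by simpa)
  -- The output bit is overwritten at every pop of the reversed input, so the verdict that survives
  -- is that on the first bit; the initial `false` is the verdict on the empty string.
  refine Prog.computableInPolyTime
    (.seq (.push 0 false) (.seq (.loop 1 (.push 2 true) (.push 2 false))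
      (.loop 2 (q b) (q !b)))) (Polynomial.X + 1) _ fun x => ?_
  have e1 : Prog.single 1 x = .mk [] x [] 0 := by
    funext i
    rcases i with _ | _ | _ | i <;> simp [Prog.single]
  have e2 : ∀ l, Prog.single 0 l = .mk l [] [] 0 := by
    intro l
    funext i
    rcases i with _ | _ | _ | i <;> simp [Prog.single]
  rw [e1, e2]
  simp only [Polynomial.eval_add, Polynomial.eval_X, Polynomial.eval_one]
  refine .seq (S' := .mk [false] x [] 0) (by simpa using Exec.push 0 false (.mk [] x [] 0))
    (.seq (S' := .mk [false] [] x.reverse 0) ?_ ?_)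
  · have : ∀ y tmp : List Bool, y.length ≤ x.length + 1 → Exec (x.length + 1)
        (.loop 1 (.push 2 true) (.push 2 false))
        (.mk [false] y tmp 0) (.mk [false] [] (y.reverse ++ tmp) 0) := by
      intro y
      induction y with
      | nil => exact fun tmp _ => .loop_nil rfl
      | cons c y ih =>
        intro tmp hM
        have := ih (c :: tmp) (by simp at hM; omega)
        refine .loop_cons (S' := .mk [false] y (c :: tmp) 0) c y rfl hM ?_ rfl
          (by simpa using this)
        have h1 := Exec.push (N := x.length + 1) 2 c (.mk [false] y tmp 0)
        cases c <;> simpa using h1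
    simpa using this x [] (by omega)
  · have : ∀ (l : List Bool) (c : Bool), l.length ≤ x.length + 1 → Exec (x.length + 1)
        (.loop 2 (q b) (q !b)) (.mk [c] [] l 0)
        (.mk [l.getLast?.elim c (fun a => decide (a = b))] [] [] 0) := by
      intro l
      induction l with
      | nil => exact fun c _ => .loop_nil rfl
      | cons a l ih =>
        intro c hM
        have := ih (decide (a = b)) (by simp at hM; omega)
        refine .loop_cons (S' := .mk [decide (a = b)] [] l 0) a l rfl hM ?_ rfl ?_
        · cases a <;> cases b <;> simpa using hq _ _ [] l c (by omega)
        · convert this using 3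
          cases l <;> simp [List.getLast?_cons]
    have h := this x.reverse false (by simp)
    convert h using 2
    cases x <;> simp

/-- If `L` or its complement many-one reduces to `B`, then `L` reduces to `B` with one query. -/
theorem oneTTReduces_of_FP {L B : Lang} {q : List Bool → List Bool} (hq : q ∈ FP) (c : Bool)
    (h : ∀ x, x ∈ L ↔ ((q x ∈ B) ↔ c = true)) : OneTTReduces L B := by
  classical
  refine ⟨q, hq, _, head_mem_P c, fun x => ?_⟩
  rw [h]
  by_cases hx : q x ∈ B <;> cases c <;> simp [hx]

/-- The statement that jumps to `exit` instead of halting, with labels embedded by `some`. -/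
def haltTo {K : Type} {Γ : K → Type} {Λ Λ' σ : Type} (emb : Λ → Λ') (exit : Λ') :
    TM2.Stmt Γ Λ σ → TM2.Stmt Γ Λ' σ
  | .push k f q => .push k f (haltTo emb exit q)
  | .peek k f q => .peek k f (haltTo emb exit q)
  | .pop k f q => .pop k f (haltTo emb exit q)
  | .load f q => .load f (haltTo emb exit q)
  | .branch f q₁ q₂ => .branch f (haltTo emb exit q₁) (haltTo emb exit q₂)
  | .goto f => .goto fun v => emb (f v)
  | .halt => .goto fun _ => exit

theorem stepAux_haltTo {K : Type} [DecidableEq K] {Γ : K → Type} {Λ Λ' σ : Type} (emb : Λ → Λ')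
    (exit : Λ') (q : TM2.Stmt Γ Λ σ) (v : σ) (S : ∀ k, List (Γ k)) :
    TM2.stepAux (haltTo emb exit q) v S =
      ⟨some ((TM2.stepAux q v S).l.elim exit emb), (TM2.stepAux q v S).var,
        (TM2.stepAux q v S).stk⟩ := by
  induction q generalizing v S with
  | push k f q ih => simp [haltTo, ih]
  | peek k f q ih => simp [haltTo, ih]
  | pop k f q ih => simp [haltTo, ih]
  | load f q ih => simp [haltTo, ih]
  | branch f q₁ q₂ ih₁ ih₂ =>
    simp only [haltTo, TM2.stepAux]
    cases f v <;> simp [ih₁, ih₂]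
  | goto f => simp [haltTo]
  | halt => simp [haltTo]

/-- Labels of an oracle machine with one query: those of the machine that computes the query, the
query label (`none`) and the two answer labels. -/
abbrev QueryLabel (Λ : Type) : Type := Option (Λ ⊕ Bool)

/-- The oracle machine that runs a given machine, queries its output, and answers whether the
answer of the oracle is `c`. -/
def oneQuery (M : TM2ComputableAux Bool Bool) (c : Bool) : OracleTM where
  tm :=
    { K := M.tm.K
      kDecidableEq := M.tm.kDecidableEq
      kFin := M.tm.kFin
      k₀ := M.tm.k₀
      k₁ := M.tm.k₁
      Γ := M.tm.Γ
      Λ := QueryLabel M.tm.Λ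
      main := some (Sum.inl M.tm.main)
      ΛFin := letI := M.tm.ΛFin; inferInstance
      σ := M.tm.σ
      initialState := M.tm.initialState
      σFin := M.tm.σFin
      Γk₀Fin := M.tm.Γk₀Fin
      m := fun l => l.elim .halt (Sum.elim
        (fun l => haltTo (fun l => some (Sum.inl l)) none (M.tm.m l))
        (fun a => .push M.tm.k₁ (fun _ => M.outputAlphabet.symm (a == c)) .halt)) }
  inputAlphabet := M.inputAlphabet
  outputAlphabet := M.outputAlphabet
  queryStack := M.tm.k₁
  queryAlphabet := M.outputAlphabet
  query := none
  yes := some (Sum.inr true)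
  no := some (Sum.inr false)

open Classical in
theorem OracleTM.step_query (M : OracleTM) (B : Lang) (c : TM2.Cfg M.tm.Γ M.tm.Λ M.tm.σ)
    (h : c.l = some M.query) :
    M.step B c = some
      { l := some (if (c.stk M.queryStack).map M.queryAlphabet ∈ B then M.yes else M.no)
        var := c.var
        stk := Function.update c.stk M.queryStack [] } :=
  if_pos h

theorem OracleTM.step_of_ne (M : OracleTM) (B : Lang) (c : TM2.Cfg M.tm.Γ M.tm.Λ M.tm.σ)
    (h : c.l ≠ some M.query) : M.step B c = TM2.step M.tm.m c :=
  if_neg h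

theorem haltList_stk (tm : FinTM2) (l : List (tm.Γ tm.k₁)) :
    (haltList tm l).stk = update (fun _ => []) tm.k₁ l := by
  funext i
  by_cases h : i = tm.k₁
  · subst h
    simp [haltList]
  · simp [haltList, h]

/-- The output stack of the machine for `q` serves as the query stack. All other stacks are empty
when that machine halts, and the query erases this one, so pushing the answer bit yields precisely
the required final configuration. The query and the push account for the two additional steps. -/
theorem turingReduces_of_FP {L B : Lang} {q : List Bool → List Bool} (hq : q ∈ FP) (c : Bool)
    (h : ∀ x, x ∈ L ↔ ((q x ∈ B) ↔ c = true)) : TuringReduces L B := by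
  classical
  obtain ⟨M⟩ := hq
  refine ⟨oneQuery M.toTM2ComputableAux c, M.time + 2, fun x => ?_⟩
  have hM := RunsIn.of_evalsToInTime (M.outputsFun x)
  simp only [id] at hM
  -- Halted configurations are sent to the query label.
  let emb : TM2.Cfg M.tm.Γ M.tm.Λ M.tm.σ → TM2.Cfg M.tm.Γ (QueryLabel M.tm.Λ) M.tm.σ :=
    fun d => ⟨some (d.l.elim none fun l => some (Sum.inl l)), d.var, d.stk⟩
  have hstep : ∀ d d', M.tm.step d = some d' →
      (oneQuery M.toTM2ComputableAux c).step B (emb d) = some (emb d') := by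
    rintro ⟨l, v, S⟩ d' hd
    cases l with
    | none => cases hd
    | some l =>
      have hd : TM2.stepAux (M.tm.m l) v S = d' := Option.some.inj hd
      refine (OracleTM.step_of_ne _ _ _ (by intro hh; cases hh)).trans ?_
      refine congrArg some ?_
      subst hd
      exact stepAux_haltTo _ _ _ v S
  have hruns : ∀ n d d', RunsIn M.tm.step n d d' →
      RunsIn ((oneQuery M.toTM2ComputableAux c).step B) n (emb d) (emb d') := by
    rintro n d d' ⟨t, ht, e⟩
    refine ⟨t, ht, ?_⟩
    clear ht
    induction t generalizing d with
    | zero => exact congrArg (Option.map emb) e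
    | succ t ih =>
      rw [Function.iterate_succ_apply] at e ⊢
      change (flip bind M.tm.step)^[t] (M.tm.step d) = _ at e
      cases hd : M.tm.step d with
      | none =>
        rw [hd] at e
        have : ∀ t, (flip bind M.tm.step)^[t] none = none := fun t =>
          Function.iterate_fixed rfl t
        rw [this] at e
        cases e
      | some d₁ =>
        rw [hd] at e
        have := ih d₁ e
        change (flip bind _)^[t] ((oneQuery M.toTM2ComputableAux c).step B (emb d)) = _
        rw [hstep d d₁ hd]
        exact this
  have h1 := hruns _ _ _ hM
  have h2 : RunsIn ((oneQuery M.toTM2ComputableAux c).step B) 1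
      (emb (haltList M.tm ((q x).map M.outputAlphabet.invFun)))
      ⟨some (some (Sum.inr (decide (q x ∈ B)))), M.tm.initialState, fun _ => []⟩ := by
    refine RunsIn.single ?_
    refine (OracleTM.step_query _ _ _ rfl).trans (congrArg some ?_)
    have e : ((haltList M.tm ((q x).map M.outputAlphabet.invFun)).stk M.tm.k₁).map
        M.outputAlphabet = q x := by
      rw [haltList_stk, Function.update_self, List.map_map]
      simp [Function.comp_def]
    refine congr (congr (congrArg TM2.Cfg.mk (congrArg some ?_)) rfl) ?_
    · refine (if_congr (iff_of_eq (congrArg (· ∈ B) e)) rfl rfl).trans ?_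
      by_cases hx : q x ∈ B <;> simp [hx, oneQuery]
    · refine (congrArg (fun f => update f M.tm.k₁ []) (haltList_stk _ _)).trans ?_
      refine (Function.update_idem _ _ _).trans ?_
      exact Function.update_eq_self M.tm.k₁ (fun _ => ([] : List (M.tm.Γ _)))
  have h3 : RunsIn ((oneQuery M.toTM2ComputableAux c).step B) 1
      ⟨some (some (Sum.inr (decide (q x ∈ B)))), M.tm.initialState, fun _ => []⟩
      (haltList (oneQuery M.toTM2ComputableAux c).tm
        [(oneQuery M.toTM2ComputableAux c).outputAlphabet.symm (decide (x ∈ L))]) := by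
    refine RunsIn.single ?_
    refine (OracleTM.step_of_ne _ _ _ (by intro hh; cases hh)).trans (congrArg some ?_)
    refine congrArg (TM2.Cfg.mk none M.tm.initialState)
      (a₁ := update (fun _ => []) M.tm.k₁ [M.outputAlphabet.symm (decide (q x ∈ B) == c)]) ?_
    refine Eq.trans ?_ (haltList_stk _ _).symm
    refine congrArg (fun a => update (fun k => ([] : List (M.tm.Γ k))) M.tm.k₁
      [M.outputAlphabet.symm a]) ?_
    rw [h]
    by_cases hx : q x ∈ B <;> cases c <;> simp [hx]
  refine (((h1.trans h2).trans h3).mono ?_).evalsToInTime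
  simp [Polynomial.eval_add, add_assoc]

end CircuitCounting

namespace CircuitCounting
open Turing StateTransition
open Function (update)

/-! ### Stack machines with elementary steps and finite alphabets -/

/-- An action on a stack. -/
inductive StackAct (Sym : Type)
  | stay
  | pop
  | push (s : Sym)

/-- The effect of an action. -/
def StackAct.apply {Sym : Type} : StackAct Sym → List Sym → List Sym
  | stay, l => l
  | pop, l => l.tail
  | push s, l => s :: l

/-- A deterministic machine with finitely many stacks over a finite alphabet. In one step each stack
is popped or pushed at most once. -/
structure StackMachine where
  State : Type
  Sym : Type
  Stk : Type
  finState : Finite State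
  finSym : Finite Sym
  finStk : Finite Stk
  start : State
  code : Bool → Sym
  input : Stk
  output : Stk
  delta : State → (Stk → Option Sym) → State × (Stk → StackAct Sym)
  accepts : Option Sym → Bool

namespace StackMachine

/-- Configurations: a state and the contents of the stacks. -/
abbrev Cfg (M : StackMachine) : Type := M.State × (M.Stk → List M.Sym)

/-- One step. -/
def step (M : StackMachine) (c : M.Cfg) : M.Cfg :=
  ((M.delta c.1 fun k => (c.2 k).head?).1,
    fun k => ((M.delta c.1 fun k => (c.2 k).head?).2 k).apply (c.2 k))

open Classical in
/-- The initial configuration. -/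
noncomputable def init (M : StackMachine) (w : List Bool) : M.Cfg :=
  (M.start, fun k => if k = M.input then w.map M.code else [])

/-- The configuration after `t` steps on input `w`. -/
noncomputable def run (M : StackMachine) (w : List Bool) (t : ℕ) : M.Cfg := M.step^[t] (M.init w)

end StackMachine

/-! ### Elementary steps of a multi-stack Turing machine -/

namespace Micro

variable {K Λ σ : Type} {Γ : K → Type}

/-- The number of elementary statements on a longest path. -/
def depth : TM2.Stmt Γ Λ σ → ℕ
  | .push _ _ q => depth q + 1
  | .peek _ _ q => depth q + 1
  | .pop _ _ q => depth q + 1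
  | .load _ q => depth q + 1
  | .branch _ q₁ q₂ => max (depth q₁) (depth q₂) + 1
  | .goto _ => 1
  | .halt => 1

variable (m : Λ → TM2.Stmt Γ Λ σ)

/-- The statements of a machine and all their parts. -/
def Sub : Type := {q : TM2.Stmt Γ Λ σ // ∃ l, q ∈ TM2.stmts₁ (m l)}

instance [Finite Λ] : Finite (Sub m) := by
  have : ({q : TM2.Stmt Γ Λ σ | ∃ l, q ∈ TM2.stmts₁ (m l)}).Finite := by
    have h : {q : TM2.Stmt Γ Λ σ | ∃ l, q ∈ TM2.stmts₁ (m l)} = ⋃ l, ↑(TM2.stmts₁ (m l)) := by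
      ext q
      simp
    rw [h]
    exact Set.finite_iUnion fun l => Finset.finite_toSet _
  exact this

open Classical in
/-- A statement as a part of the machine. -/
noncomputable def toSub (q : TM2.Stmt Γ Λ σ) : Option (Sub m) :=
  if h : ∃ l, q ∈ TM2.stmts₁ (m l) then some ⟨q, h⟩ else none

theorem toSub_eq {q : TM2.Stmt Γ Λ σ} (h : ∃ l, q ∈ TM2.stmts₁ (m l)) :
    toSub m q = some ⟨q, h⟩ := dif_pos h

/-- Symbols are input bits, or refer to the push statement that produced them and to the internal
state at that time. -/
abbrev Sym : Type := Bool ⊕ (Sub m × σ)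

variable [DecidableEq K] {k₀ k₁ : K} (inp : Bool → Γ k₀)

/-- The stack element represented by a symbol. -/
noncomputable def dec (k : K) : Sym m → Option (Γ k)
  | Sum.inl b => if h : k₀ = k then some (h ▸ inp b) else none
  | Sum.inr (⟨.push k' f _, _⟩, v) => if h : k' = k then some (h ▸ f v) else none
  | Sum.inr _ => none

/-- One elementary step. -/
noncomputable def delta : Option (Sub m) × σ → (K → Option (Sym m)) →
    (Option (Sub m) × σ) × (K → StackAct (Sym m))
  | (none, v), _ => ((none, v), fun _ => .stay)
  | (some ⟨.push k f q, h⟩, v), _ =>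
    ((toSub m q, v), update (fun _ => .stay) k (.push (Sum.inr (⟨.push k f q, h⟩, v))))
  | (some ⟨.peek k f q, _⟩, v), t =>
    ((toSub m q, f v ((t k).bind (dec m inp k))), fun _ => .stay)
  | (some ⟨.pop k f q, _⟩, v), t =>
    ((toSub m q, f v ((t k).bind (dec m inp k))), update (fun _ => .stay) k .pop)
  | (some ⟨.load f q, _⟩, v), _ => ((toSub m q, f v), fun _ => .stay)
  | (some ⟨.branch f q₁ q₂, _⟩, v), _ =>
    ((toSub m (bif f v then q₁ else q₂), v), fun _ => .stay)
  | (some ⟨.goto f, _⟩, v), _ => ((toSub m (m (f v)), v), fun _ => .stay)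
  | (some ⟨.halt, _⟩, v), _ => ((none, v), fun _ => .stay)

open Classical in
/-- The stack machine that executes the elementary steps. -/
noncomputable def machine [Finite K] [Finite Λ] [Finite σ] (main : Λ) (v₀ : σ) (k₁ : K)
    (acc : Γ k₁) : StackMachine where
  State := Option (Sub m) × σ
  Sym := Sym m
  Stk := K
  finState := inferInstance
  finSym := inferInstance
  finStk := inferInstance
  start := (toSub m (m main), v₀)
  code := Sum.inl
  input := k₀
  output := k₁
  delta := delta m inp
  accepts := fun o => decide (o.bind (dec m inp k₁) = some acc)

/-- The symbols on the stacks `S'` represent the stacks `S`. -/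
def Represents (S : ∀ k, List (Γ k)) (S' : K → List (Sym m)) : Prop :=
  ∀ k, (S' k).map (dec m inp k) = (S k).map some

variable {m inp}

theorem Represents.head {S : ∀ k, List (Γ k)} {S' : K → List (Sym m)} (h : Represents m inp S S')
    (k : K) : (S' k).head?.bind (dec m inp k) = (S k).head? := by
  have := congrArg List.head? (h k)
  rw [List.head?_map, List.head?_map] at this
  cases h1 : (S' k).head? <;> cases h2 : (S k).head? <;> simp_all

variable [Finite K] [Finite Λ] [Finite σ] (main : Λ) (v₀ : σ) (k₁ : K) (acc : Γ k₁)

/-- A single TM2 statement may access the same stack several times; executing its parts one by one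
costs at most its depth. No finiteness of the alphabets `Γ k` is assumed: an element is represented
by the push statement and internal state that created it, of which there are finitely many, and
`dec` recovers it. -/
theorem steps_stepAux (q : TM2.Stmt Γ Λ σ) : ∀ (hq : ∃ l, q ∈ TM2.stmts₁ (m l)) (v : σ)
    (S : ∀ k, List (Γ k)) (S' : K → List (Sym m)), Represents m inp S S' →
    ∃ t ≤ depth q, ∃ S'', ((machine m inp main v₀ k₁ acc).step)^[t] ((some ⟨q, hq⟩, v), S') =
      (((TM2.stepAux q v S).l.bind fun l => toSub m (m l), (TM2.stepAux q v S).var), S'') ∧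
      Represents m inp (TM2.stepAux q v S).stk S'' := by
  have sub : ∀ {q q' : TM2.Stmt Γ Λ σ}, q' ∈ TM2.stmts₁ q → (∃ l, q ∈ TM2.stmts₁ (m l)) →
      ∃ l, q' ∈ TM2.stmts₁ (m l) := fun h ⟨l, hl⟩ => ⟨l, TM2.stmts₁_trans hl h⟩
  -- Common to all non-terminal statements: one elementary step, then the induction hypothesis for
  -- the remaining statement.
  have next : ∀ {q Q : TM2.Stmt Γ Λ σ} {hQ : ∃ l, Q ∈ TM2.stmts₁ (m l)} {v v' : σ}
      {S₁ : ∀ k, List (Γ k)} {S' S₁' : K → List (Sym m)} {c : TM2.Cfg Γ Λ σ},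
      (∀ (hq : ∃ l, q ∈ TM2.stmts₁ (m l)) (v : σ) (S : ∀ k, List (Γ k)) (S' : K → List (Sym m)),
        Represents m inp S S' → ∃ t ≤ depth q, ∃ S'',
        ((machine m inp main v₀ k₁ acc).step)^[t] ((some ⟨q, hq⟩, v), S') =
          (((TM2.stepAux q v S).l.bind fun l => toSub m (m l), (TM2.stepAux q v S).var), S'') ∧
          Represents m inp (TM2.stepAux q v S).stk S'') →
      q ∈ TM2.stmts₁ Q → depth q < depth Q →
      (machine m inp main v₀ k₁ acc).step ((some ⟨Q, hQ⟩, v), S') = ((toSub m q, v'), S₁') →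
      Represents m inp S₁ S₁' → c = TM2.stepAux q v' S₁ →
      ∃ t ≤ depth Q, ∃ S'', ((machine m inp main v₀ k₁ acc).step)^[t] ((some ⟨Q, hQ⟩, v), S') =
        ((c.l.bind fun l => toSub m (m l), c.var), S'') ∧ Represents m inp c.stk S'' := by
    rintro q Q hQ v v' S₁ S' S₁' c ih hq hd e hS rfl
    obtain ⟨t, ht, S'', e', h⟩ := ih (sub hq hQ) v' S₁ S₁' hS
    refine ⟨t + 1, by omega, S'', ?_, h⟩
    rw [Function.iterate_succ_apply, e, toSub_eq m (sub hq hQ)]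
    exact e'
  induction q with
  | push k f q ih =>
    intro hq v S S' hS
    refine next ih (by simp [TM2.stmts₁, TM2.stmts₁_self]) (by simp [depth])
      (v' := v) (S₁' := fun k' => (update (fun _ => StackAct.stay) k
        (StackAct.push (Sum.inr (⟨.push k f q, hq⟩, v))) k').apply (S' k')) rfl
      (S₁ := update S k (f v :: S k)) (fun k' => ?_) rfl
    by_cases hk : k' = k
    · subst hk
      simpa [StackAct.apply, dec] using hS k'
    · simpa [StackAct.apply, hk] using hS k'
  | peek k f q ih =>
    intro hq v S S' hS
    exact next ih (by simp [TM2.stmts₁, TM2.stmts₁_self]) (by simp [depth]) rfl hS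
      (congrArg (fun o => TM2.stepAux q (f v o) S) (hS.head k).symm)
  | pop k f q ih =>
    intro hq v S S' hS
    refine next ih (by simp [TM2.stmts₁, TM2.stmts₁_self]) (by simp [depth])
      (S₁' := fun k' => (update (fun _ => StackAct.stay) k StackAct.pop k').apply (S' k')) rfl
      (S₁ := update S k (S k).tail) (fun k' => ?_)
      (congrArg (fun o => TM2.stepAux q (f v o) _) (hS.head k).symm)
    by_cases hk : k' = k
    · subst hk
      simp only [StackAct.apply, Function.update_self, List.map_tail, hS k']
    · simpa [StackAct.apply, hk] using hS k'
  | load f q ih =>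
    intro hq v S S' hS
    exact next ih (by simp [TM2.stmts₁, TM2.stmts₁_self]) (by simp [depth]) rfl hS rfl
  | branch f q₁ q₂ ih₁ ih₂ =>
    intro hq v S S' hS
    cases hf : f v with
    | true =>
      exact next ih₁ (by simp [TM2.stmts₁, TM2.stmts₁_self]) (by simp [depth])

        (congrArg (fun b => ((toSub m (bif b then q₁ else q₂), v), S')) hf) hS
        (congrArg (fun b => cond b (TM2.stepAux q₁ v S) (TM2.stepAux q₂ v S)) hf)
    | false =>
      exact next ih₂ (by simp [TM2.stmts₁, TM2.stmts₁_self]) (by simp [depth])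

        (congrArg (fun b => ((toSub m (bif b then q₁ else q₂), v), S')) hf) hS
        (congrArg (fun b => cond b (TM2.stepAux q₁ v S) (TM2.stepAux q₂ v S)) hf)
  | goto f =>
    intro hq v S S' hS
    exact ⟨1, le_rfl, S', rfl, hS⟩
  | halt =>
    intro hq v S S' hS
    exact ⟨1, le_rfl, S', rfl, hS⟩

theorem steps_of_runsIn {D : ℕ} (hD : ∀ l, depth (m l) ≤ D) {n : ℕ} {c c' : TM2.Cfg Γ Λ σ}
    (h : RunsIn (TM2.step m) n c c') (S' : K → List (Sym m)) (hS : Represents m inp c.stk S') :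
    ∃ t ≤ D * n, ∃ S'', ((machine m inp main v₀ k₁ acc).step)^[t]
        ((c.l.bind fun l => toSub m (m l), c.var), S') =
      ((c'.l.bind fun l => toSub m (m l), c'.var), S'') ∧ Represents m inp c'.stk S'' := by
  obtain ⟨s, hs, e⟩ := h
  suffices ∃ t ≤ D * s, ∃ S'', ((machine m inp main v₀ k₁ acc).step)^[t]
        ((c.l.bind fun l => toSub m (m l), c.var), S') =
      ((c'.l.bind fun l => toSub m (m l), c'.var), S'') ∧ Represents m inp c'.stk S'' by
    obtain ⟨t, ht, r⟩ := this
    exact ⟨t, ht.trans (Nat.mul_le_mul_left D hs), r⟩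
  clear hs
  induction s generalizing c S' with
  | zero =>
    obtain rfl : c = c' := Option.some.inj e
    exact ⟨0, le_rfl, S', rfl, hS⟩
  | succ s ih =>
    rw [Function.iterate_succ_apply] at e
    change (flip bind (TM2.step m))^[s] (TM2.step m c) = _ at e
    obtain ⟨l, v, S⟩ := c
    cases l with
    | none =>
      have : ∀ t, (flip bind (TM2.step m))^[t] none = none := fun t =>
        Function.iterate_fixed rfl t
      rw [TM2.step, this] at e
      cases e
    | some l =>
      have hl : ∃ l', m l ∈ TM2.stmts₁ (m l') := ⟨l, TM2.stmts₁_self⟩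
      obtain ⟨t₁, ht₁, S₁, e₁, h₁⟩ := steps_stepAux main v₀ k₁ acc (m l) hl v S S' hS
      obtain ⟨t₂, ht₂, S₂, e₂, h₂⟩ := ih S₁ h₁ e
      refine ⟨t₂ + t₁, ?_, S₂, ?_, h₂⟩
      · have := hD l
        rw [Nat.mul_succ]
        omega
      · rw [Function.iterate_add_apply]
        simp only [Option.bind_some, toSub_eq m hl]
        exact (congrArg _ e₁).trans e₂

end Micro

/-- A language in `P` is decided by a stack machine within polynomially many steps, where the
configuration keeps the decision forever. -/
theorem exists_stackMachine {L : Lang} (hL : L ∈ P) :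
    ∃ (M : StackMachine) (p : Polynomial ℕ), ∀ (w : List Bool) (t : ℕ), p.eval w.length ≤ t →
      (M.accepts ((M.run w t).2 M.output).head? = true ↔ w ∈ L) := by
  classical
  obtain ⟨T⟩ := hL
  let _ := T.tm.ΛFin
  let _ := T.tm.kFin
  let _ := T.tm.σFin
  let inp : Bool → T.tm.Γ T.tm.k₀ := T.inputAlphabet.symm
  let D := Finset.univ.sup fun l => Micro.depth (T.tm.m l)
  have hD : ∀ l, Micro.depth (T.tm.m l) ≤ D := fun l =>
    Finset.le_sup (f := fun l => Micro.depth (T.tm.m l)) (Finset.mem_univ l)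
  let M := Micro.machine T.tm.m inp T.tm.main T.tm.initialState T.tm.k₁
    (T.outputAlphabet.symm true)
  refine ⟨M, Polynomial.C D * T.time, fun w t ht => ?_⟩
  have hr := RunsIn.of_evalsToInTime (T.outputsFun w)
  obtain ⟨s, hs, S, e, hS⟩ := Micro.steps_of_runsIn (inp := inp) T.tm.main T.tm.initialState T.tm.k₁
    (T.outputAlphabet.symm true) hD hr (M.init w).2 (by
      intro k
      by_cases hk : k = T.tm.k₀
      · subst hk
        simp [M, StackMachine.init, Micro.machine, initList, Micro.dec, inp, Function.comp_def]
      · simp [M, StackMachine.init, Micro.machine, initList, hk])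
  -- A halted configuration is a fixed point of the step function, so the decision stays readable at
  -- all later times.
  have hrun : ∀ u, M.run w (u + s) = ((none, T.tm.initialState), S) := by
    intro u
    rw [StackMachine.run, Function.iterate_add_apply]
    refine (congrArg (M.step^[u]) e).trans ?_
    exact Function.iterate_fixed rfl u
  have hst : t = (t - s) + s := by
    simp only [Polynomial.eval_mul, Polynomial.eval_C, id] at ht hs
    omega
  rw [hst, hrun]
  have h1 := hS.head T.tm.k₁
  rw [haltList_stk, Function.update_self] at h1
  change decide ((S T.tm.k₁).head?.bind _ = _) = true ↔ _
  refine decide_eq_true_iff.trans ?_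
  refine (iff_of_eq (congrArg (· = _) h1)).trans ?_
  simp

end CircuitCounting

namespace CircuitCounting
open Function (update)

/-! ### Runs of gate lists -/

theorem run_append (w : List Bool) (a b : List Gate) : run w (a ++ b) = run (run w a) b := by
  induction a generalizing w with
  | nil => rfl
  | cons g a ih => exact ih _

@[simp] theorem length_run (w : List Bool) (a : List Gate) :
    (run w a).length = w.length + a.length := by
  induction a generalizing w with
  | nil => rfl
  | cons g a ih => rw [run, ih]; simp; omega

theorem getD_run_of_lt {w : List Bool} (a : List Gate) {i : ℕ} (h : i < w.length) :
    (run w a).getD i false = w.getD i false := by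
  induction a generalizing w with
  | nil => rfl
  | cons g a ih =>
    rw [run, ih (by simp; omega)]
    exact List.getD_append _ _ _ _ h

theorem wellFormed_append (m : ℕ) (a b : List Gate) :
    WellFormed m (a ++ b) ↔ WellFormed m a ∧ WellFormed (m + a.length) b := by
  induction a generalizing m with
  | nil => simp [WellFormed]
  | cons g a ih =>
    simp only [List.cons_append, WellFormed, ih, List.length_cons, and_assoc]
    rw [show m + 1 + a.length = m + (a.length + 1) by omega]

theorem getD_run_concat (w : List Bool) (a : List Gate) (g : Gate) :
    (run w (a ++ [g])).getD (w.length + a.length) false = g.eval (run w a) := by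
  rw [run_append]
  change (run w a ++ [g.eval (run w a)]).getD _ _ = _
  rw [List.getD_append_right _ _ _ _ (by simp)]
  simp

/-! ### Boolean formulas -/

/-- Boolean formulas with variables from `ι`. -/
inductive Formula (ι : Type)
  | const (b : Bool)
  | var (i : ι)
  | neg (a : Formula ι)
  | conj (a b : Formula ι)
  | disj (a b : Formula ι)

namespace Formula

variable {ι : Type}

/-- The value of a formula. -/
def eval (v : ι → Bool) : Formula ι → Bool
  | const b => b
  | var i => v i
  | neg a => !a.eval v
  | conj a b => a.eval v && b.eval v
  | disj a b => a.eval v || b.eval v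

theorem exists_any {α : Type*} (l : List α) (f : α → Formula ι) :
    ∃ F : Formula ι, ∀ v, F.eval v = l.any fun i => (f i).eval v := by
  induction l with
  | nil => exact ⟨const false, fun v => rfl⟩
  | cons i l ih =>
    obtain ⟨F, hF⟩ := ih
    exact ⟨disj (f i) F, fun v => by simp [eval, hF]⟩

theorem exists_all {α : Type*} (l : List α) (f : α → Formula ι) :
    ∃ F : Formula ι, ∀ v, F.eval v = l.all fun i => (f i).eval v := by
  induction l with
  | nil => exact ⟨const true, fun v => rfl⟩
  | cons i l ih =>
    obtain ⟨F, hF⟩ := ih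
    exact ⟨conj (f i) F, fun v => by simp [eval, hF]⟩

/-- Every Boolean function is given by a formula. -/
theorem exists_eval_eq [Fintype ι] [DecidableEq ι] (φ : (ι → Bool) → Bool) : ∃ F : Formula ι, ∀ v, F.eval v = φ v := by
  have h : ∀ u : ι → Bool, ∃ F : Formula ι, ∀ v, F.eval v = decide (v = u) := by
    intro u
    obtain ⟨F, hF⟩ := exists_all (Finset.univ.toList : List ι)
      (fun i => if u i = true then var i else neg (var i))
    refine ⟨F, fun v => ?_⟩
    rw [hF, Bool.eq_iff_iff, List.all_eq_true, decide_eq_true_iff, funext_iff]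
    refine ⟨fun h i => ?_, fun h i _ => ?_⟩
    · have := h i (by simp)
      cases hu : u i <;> simp_all [eval]
    · have := h i
      cases hu : u i <;> simp_all [eval]
  choose F hF using h
  obtain ⟨E, hE⟩ := exists_any (Finset.univ.toList : List (ι → Bool))
    (fun u => if φ u = true then F u else const false)
  refine ⟨E, fun v => ?_⟩
  rw [hE, Bool.eq_iff_iff, List.any_eq_true]
  constructor
  · rintro ⟨u, -, hu⟩
    by_cases hφ : φ u = true
    · rw [if_pos hφ, hF, decide_eq_true_iff] at hu
      rwa [hu]
    · rw [if_neg hφ] at hu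
      cases hu
  · intro hv
    exact ⟨v, by simp, by rw [if_pos hv, hF]; simp⟩

/-- The number of gates for a formula. -/
def size : Formula ι → ℕ
  | const _ => 1
  | var _ => 1
  | neg a => a.size + 1
  | conj a b => a.size + b.size + 1
  | disj a b => a.size + b.size + 1

theorem size_pos : ∀ F : Formula ι, 0 < F.size
  | const _ => Nat.one_pos
  | var _ => Nat.one_pos
  | neg _ => Nat.succ_pos _
  | conj _ _ => Nat.succ_pos _
  | disj _ _ => Nat.succ_pos _

/-- The gates for a formula, where `base` wires precede them and variable `i` is wire `inp i`. -/
def gates (inp : ι → ℕ) : Formula ι → ℕ → List Gate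
  | const b, _ => [.const b]
  -- A copy gate, so that the value of every formula appears on the last wire of its own gates.
  | var i, _ => [.conj (inp i) (inp i)]
  | neg a, base => a.gates inp base ++ [.neg (base + (a.size - 1))]
  | conj a b, base => a.gates inp base ++ b.gates inp (base + a.size) ++
      [.conj (base + (a.size - 1)) (base + a.size + (b.size - 1))]
  | disj a b, base => a.gates inp base ++ b.gates inp (base + a.size) ++
      [.disj (base + (a.size - 1)) (base + a.size + (b.size - 1))]

variable (inp : ι → ℕ)

@[simp] theorem length_gates : ∀ (F : Formula ι) (base : ℕ), (F.gates inp base).length = F.size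
  | const _, _ => rfl
  | var _, _ => rfl
  | neg a, base => by simp [gates, size, length_gates a]
  | conj a b, base => by simp [gates, size, length_gates a, length_gates b, add_assoc]
  | disj a b, base => by simp [gates, size, length_gates a, length_gates b, add_assoc]

theorem wellFormed_gates : ∀ (F : Formula ι) (base : ℕ), (∀ i, inp i < base) →
    WellFormed base (F.gates inp base)
  | const _, _, _ => ⟨by simp [Gate.sources], trivial⟩
  | var i, base, h => ⟨by simpa [Gate.sources] using h i, trivial⟩
  | neg a, base, h => by
    have := a.size_pos
    rw [gates, wellFormed_append]
    refine ⟨wellFormed_gates a base h, ?_, trivial⟩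
    simp [Gate.sources]
    omega
  | conj a b, base, h => by
    have := a.size_pos
    have := b.size_pos
    rw [gates, wellFormed_append, wellFormed_append, length_gates]
    refine ⟨⟨wellFormed_gates a base h, wellFormed_gates b _ fun i => ?_⟩, ?_, trivial⟩
    · have := h i; omega
    · simp [Gate.sources]; omega
  | disj a b, base, h => by
    have := a.size_pos
    have := b.size_pos
    rw [gates, wellFormed_append, wellFormed_append, length_gates]
    refine ⟨⟨wellFormed_gates a base h, wellFormed_gates b _ fun i => ?_⟩, ?_, trivial⟩
    · have := h i; omega
    · simp [Gate.sources]; omega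

theorem getD_run_gates : ∀ (F : Formula ι) (W : List Bool), (∀ i, inp i < W.length) →
    (run W (F.gates inp W.length)).getD (W.length + (F.size - 1)) false =
      F.eval fun i => W.getD (inp i) false
  | const b, W, _ => getD_run_concat W [] _
  | var i, W, _ => (getD_run_concat W [] _).trans (Bool.and_self _)
  | neg a, W, h => by
    have := getD_run_concat W (a.gates inp W.length) (.neg (W.length + (a.size - 1)))
    rw [length_gates] at this
    simp only [gates, size, Nat.add_sub_cancel, eval]
    rw [this, Gate.eval, getD_run_gates a W h]
  | conj a b, W, h => by
    have ha := a.size_pos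
    have hl : (run W (a.gates inp W.length)).length = W.length + a.size := by simp
    have := getD_run_concat W (a.gates inp W.length ++ b.gates inp (W.length + a.size))
      (.conj (W.length + (a.size - 1)) (W.length + a.size + (b.size - 1)))
    rw [List.length_append, length_gates, length_gates] at this
    simp only [gates, size, Nat.add_sub_cancel, eval]
    rw [this, Gate.eval, run_append, getD_run_of_lt _ (by rw [hl]; omega), getD_run_gates a W h,
      ← hl, getD_run_gates b _ fun i => by rw [hl]; have := h i; omega]
    simp only [getD_run_of_lt _ (h _)]
  | disj a b, W, h => by
    have ha := a.size_pos
    have hl : (run W (a.gates inp W.length)).length = W.length + a.size := by simp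
    have := getD_run_concat W (a.gates inp W.length ++ b.gates inp (W.length + a.size))
      (.disj (W.length + (a.size - 1)) (W.length + a.size + (b.size - 1)))
    rw [List.length_append, length_gates, length_gates] at this
    simp only [gates, size, Nat.add_sub_cancel, eval]
    rw [this, Gate.eval, run_append, getD_run_of_lt _ (by rw [hl]; omega), getD_run_gates a W h,
      ← hl, getD_run_gates b _ fun i => by rw [hl]; have := h i; omega]
    simp only [getD_run_of_lt _ (h _)]

/-- The gates for a formula, preceded by constant gates so that there are `B` gates in all. -/
def padded (B : ℕ) (F : Formula ι) (base : ℕ) : List Gate :=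
  List.replicate (B - F.size) (.const false) ++ F.gates inp (base + (B - F.size))

/-- Blocks of `B` gates for each of several formulas. -/
def block (B : ℕ) : List (Formula ι) → ℕ → List Gate
  | [], _ => []
  | F :: l, base => F.padded inp B base ++ block B l (base + B)

variable {B : ℕ}

theorem length_padded {F : Formula ι} (hF : F.size ≤ B) (base : ℕ) :
    (F.padded inp B base).length = B := by
  simp [padded]
  omega

theorem wellFormed_replicate (m n : ℕ) (b : Bool) :
    WellFormed m (List.replicate n (.const b)) := by
  induction n generalizing m with
  | zero => trivial
  | succ n ih => exact ⟨by simp [Gate.sources], ih _⟩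

theorem wellFormed_padded (F : Formula ι) (base : ℕ) (h : ∀ i, inp i < base) :
    WellFormed base (F.padded inp B base) := by
  rw [padded, wellFormed_append, List.length_replicate]
  exact ⟨wellFormed_replicate _ _ _, F.wellFormed_gates inp _ fun i => (h i).trans_le (by omega)⟩

theorem getD_run_padded {F : Formula ι} (hF : F.size ≤ B) (W : List Bool)
    (h : ∀ i, inp i < W.length) :
    (run W (F.padded inp B W.length)).getD (W.length + (B - 1)) false =
      F.eval fun i => W.getD (inp i) false := by
  have hp := F.size_pos
  have hl : (run W (List.replicate (B - F.size) (.const false))).length =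
      W.length + (B - F.size) := by simp
  have := getD_run_gates inp F (run W (List.replicate (B - F.size) (.const false)))
    (fun i => by rw [hl]; have := h i; omega)
  rw [padded, run_append, ← hl]
  rw [show W.length + (B - 1) = (run W (List.replicate (B - F.size) (.const false))).length +
    (F.size - 1) by rw [hl]; omega, this]
  simp only [getD_run_of_lt _ (h _)]

theorem length_block {l : List (Formula ι)} (hl : ∀ F ∈ l, F.size ≤ B) (base : ℕ) :
    (block inp B l base).length = l.length * B := by
  induction l generalizing base with
  | nil => simp [block]
  | cons F l ih =>
    rw [block, List.length_append, length_padded inp (hl F (by simp)),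
      ih (fun F hF => hl F (by simp [hF])), List.length_cons]
    ring

theorem wellFormed_block {l : List (Formula ι)} (hl : ∀ F ∈ l, F.size ≤ B) (base : ℕ)
    (h : ∀ i, inp i < base) : WellFormed base (block inp B l base) := by
  induction l generalizing base with
  | nil => trivial
  | cons F l ih =>
    rw [block, wellFormed_append, length_padded inp (hl F (by simp))]
    exact ⟨wellFormed_padded inp F base h, ih (fun F hF => hl F (by simp [hF])) _
      fun i => (h i).trans_le (by omega)⟩

/-- All formulas read wires before the whole block and are padded to the same length. So value
number `j` sits on a wire that is affine in `j`, and wire numbers can later be computed by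
arithmetic expressions. -/
theorem getD_run_block {l : List (Formula ι)} (hl : ∀ F ∈ l, F.size ≤ B) (W : List Bool)
    (h : ∀ i, inp i < W.length) {j : ℕ} (hj : j < l.length) :
    (run W (block inp B l W.length)).getD (W.length + (j * B + (B - 1))) false =
      l[j].eval fun i => W.getD (inp i) false := by
  induction l generalizing W j with
  | nil => simp at hj
  | cons F l ih =>
    have hF := hl F (by simp)
    have hp := F.size_pos
    have hlen : (run W (F.padded inp B W.length)).length = W.length + B := by
      rw [length_run, length_padded inp hF]
    rw [block, run_append]
    cases j with
    | zero =>
      rw [getD_run_of_lt _ (by rw [hlen]; omega), zero_mul, zero_add,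
        getD_run_padded inp hF W h]
      rfl
    | succ j =>
      have := ih (fun F hF => hl F (by simp [hF])) (run W (F.padded inp B W.length))
        (fun i => by rw [hlen]; have := h i; omega) (j := j) (by simpa using hj)
      rw [hlen] at this
      rw [show W.length + ((j + 1) * B + (B - 1)) = W.length + B + (j * B + (B - 1)) by ring, this]
      simp only [getD_run_of_lt _ (h _), List.getElem_cons_succ]

end Formula

/-! ### Emission of gates -/

/-- The code of a list of gates without the end marker. -/
def gatesCode (l : List Gate) : List Bool := l.flatMap fun g => true :: g.encode

theorem encodeGates_eq (l : List Gate) : encodeGates l = gatesCode l ++ [false] := by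
  induction l with
  | nil => rfl
  | cons g l ih => simp [encodeGates, ih, gatesCode]

theorem Emits.congr {d : ℕ} {w w' : List Bool → (ℕ → ℕ) → List Bool} (h : Emits d w)
    (e : ∀ x env, w x env = w' x env) : Emits d w' := by
  obtain rfl : w = w' := by
    funext x env
    exact e x env
  exact h

theorem Emits.unary {d : ℕ} {f : (ℕ → ℕ) → ℕ} (hf : IsExpr d f) :
    Emits d fun _ env => unary (f env) := by
  refine ((Emits.loop hf (Emits.lit [true])).append (Emits.lit [false])).congr fun x env => ?_
  rw [CircuitCounting.unary]
  congr 1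
  generalize f env = n
  induction n with
  | zero => rfl
  | succ n ih => rw [List.range_succ, List.flatMap_append, ih, List.replicate_succ']; rfl

/-- The lists of gates that depend on a string and `d` counters can be emitted. -/
def EmitsGates (d : ℕ) (g : List Bool → (ℕ → ℕ) → List Gate) : Prop :=
  Emits d fun x env => gatesCode (g x env)

namespace EmitsGates

variable {d : ℕ} {g g' : List Bool → (ℕ → ℕ) → List Gate} {f f' : (ℕ → ℕ) → ℕ}

theorem append (h : EmitsGates d g) (h' : EmitsGates d g') :
    EmitsGates d fun x env => g x env ++ g' x env :=
  (Emits.append h h').congr fun x env => by simp [gatesCode]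

theorem fixed (l : List Gate) : EmitsGates d fun _ _ => l := Emits.lit (gatesCode l)

theorem neg (hf : IsExpr d f) : EmitsGates d fun _ env => [.neg (f env)] :=
  ((Emits.lit [true, false, true]).append (Emits.unary hf)).congr fun x env => by
    simp [gatesCode, Gate.encode]

theorem conj (hf : IsExpr d f) (hf' : IsExpr d f') :
    EmitsGates d fun _ env => [.conj (f env) (f' env)] :=
  ((Emits.lit [true, true, false]).append ((Emits.unary hf).append (Emits.unary hf'))).congr
    fun x env => by simp [gatesCode, Gate.encode]

theorem disj (hf : IsExpr d f) (hf' : IsExpr d f') :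
    EmitsGates d fun _ env => [.disj (f env) (f' env)] :=
  ((Emits.lit [true, true, true]).append ((Emits.unary hf).append (Emits.unary hf'))).congr
    fun x env => by simp [gatesCode, Gate.encode]

theorem bits (h : Bool → List Gate) : EmitsGates d fun x _ => x.flatMap h :=
  (Emits.bits fun b => gatesCode (h b)).congr fun x env => by
    simp [gatesCode, List.flatMap_assoc]

theorem loop (hf : IsExpr d f) (h : EmitsGates (d + 1) g) :
    EmitsGates d fun x env => (List.range (f env)).flatMap fun i => g x (update env d i) :=
  (Emits.loop hf h).congr fun x env => by simp [gatesCode, List.flatMap_assoc]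

variable {ι : Type} {inp : (ℕ → ℕ) → ι → ℕ} {base : (ℕ → ℕ) → ℕ}

theorem formula (hinp : ∀ i, IsExpr d fun env => inp env i) : ∀ (F : Formula ι)
    {base : (ℕ → ℕ) → ℕ}, IsExpr d base →
    EmitsGates d fun _ env => F.gates (inp env) (base env)
  | .const _, _, _ => fixed _
  | .var i, _, _ => conj (hinp i) (hinp i)
  | .neg a, _, h => (formula hinp a h).append (neg (h.add (.const _)))
  | .conj a b, _, h => ((formula hinp a h).append (formula hinp b (h.add (.const _)))).append
      (conj (h.add (.const _)) ((h.add (.const _)).add (.const _)))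
  | .disj a b, _, h => ((formula hinp a h).append (formula hinp b (h.add (.const _)))).append
      (disj (h.add (.const _)) ((h.add (.const _)).add (.const _)))

theorem block (B : ℕ) (hinp : ∀ i, IsExpr d fun env => inp env i) (l : List (Formula ι))
    (h : IsExpr d base) : EmitsGates d fun _ env => Formula.block (inp env) B l (base env) := by
  induction l generalizing base with
  | nil => exact fixed []
  | cons F l ih =>
    exact ((fixed _).append (formula hinp F (h.add (.const _)))).append (ih (h.add (.const _)))

end EmitsGates

end CircuitCounting

namespace CircuitCounting
open Function (update)

/-! ### One-dimensional automata with a head cell -/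

/-- An automaton on a one-sided infinite row of cells. The first cell is the head, which is seen by
all cells, as is the first body cell. The initial row depends on selector bits, which go to the head,
on a fixed string, and on columns of `width` bits. -/
structure Automaton where
  Hd : Type
  Bd : Type
  finHd : Finite Hd
  finBd : Finite Bd
  hstep : Hd → Bd → Hd
  bstep : Hd → Bd → Option Bd → Bd → Bd → Bd
  accepts : Hd → Bool
  sel : ℕ
  width : ℕ
  head : (Fin sel → Bool) → Hd
  col : (Fin width → Bool) → Bd
  letter : Bool → Bd
  blank : Bd

/-- The part of the pair `⟨x, y⟩` before `y`. -/
def pairPrefix (x : List Bool) : List Bool := x.flatMap (fun b => [b, b]) ++ [false, true]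

theorem pair_eq (x y : List Bool) : pair x y = pairPrefix x ++ y := by
  simp [pair, pairPrefix]

theorem length_pairPrefix (x : List Bool) : (pairPrefix x).length = 2 * x.length + 2 := by
  induction x with
  | nil => rfl
  | cons b x ih => simp [pairPrefix] at ih ⊢; omega

namespace Automaton

variable (A : Automaton)

/-- The contents of a cell. -/
abbrev Cell : Type := A.Hd ⊕ A.Bd

/-- The non-blank body cells of the initial row. -/
def initBody (x : List Bool) (m : ℕ) (u : ℕ → Fin A.width → Bool) : List A.Bd :=
  (pairPrefix x).map A.letter ++ (List.range m).map fun j => A.col (u j)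

/-- The row of cells after `t` steps. -/
def row (x : List Bool) (m : ℕ) (z : Fin A.sel → Bool) (u : ℕ → Fin A.width → Bool) :
    ℕ → A.Hd × (ℕ → A.Bd)
  | 0 => (A.head z, fun j => (A.initBody x m u).getD j A.blank)
  | t + 1 =>
    let r := row x m z u t
    (A.hstep r.1 (r.2 0), fun j => A.bstep r.1 (r.2 0)
      (j.casesOn none fun i => some (r.2 i)) (r.2 j) (r.2 (j + 1)))

/-- The cells after `t` steps. -/
def cell (x : List Bool) (m : ℕ) (z : Fin A.sel → Bool) (u : ℕ → Fin A.width → Bool) (t : ℕ) :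
    ℕ → A.Cell
  | 0 => Sum.inl (A.row x m z u t).1
  | j + 1 => Sum.inr ((A.row x m z u t).2 j)

/-- A binary encoding of the cells, with formulas for the transitions and for the initial cells. -/
structure Formulas where
  w : ℕ
  enc : A.Cell → Fin (w + 1) → Bool
  enc_head : ∀ h, enc (Sum.inl h) 0 = A.accepts h
  bound : ℕ
  bound_pos : 0 < bound
  step : List (Formula (Fin 5 × Fin (w + 1)))
  head : List (Formula (Fin A.sel))
  col : List (Formula (Fin A.width))
  length_step : step.length = w + 1
  length_head : head.length = w + 1
  length_col : col.length = w + 1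
  size_step : ∀ F ∈ step, F.size ≤ bound
  size_head : ∀ F ∈ head, F.size ≤ bound
  size_col : ∀ F ∈ col, F.size ≤ bound
  eval_head : ∀ (z) (j : Fin (w + 1)),
    (head[j]'(by rw [length_head]; exact j.2)).eval z = enc (Sum.inl (A.head z)) j
  eval_col : ∀ (u) (j : Fin (w + 1)),
    (col[j]'(by rw [length_col]; exact j.2)).eval u = enc (Sum.inr (A.col u)) j
  eval_step_head : ∀ (v : Fin 5 × Fin (w + 1) → Bool) (h c), (∀ i, v (0, i) = enc (Sum.inl h) i) →
    (∀ i, v (1, i) = enc (Sum.inr c) i) → (∀ i, v (3, i) = enc (Sum.inl h) i) →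
    ∀ j : Fin (w + 1), (step[j]'(by rw [length_step]; exact j.2)).eval v =
      enc (Sum.inl (A.hstep h c)) j
  eval_step_body : ∀ (v : Fin 5 × Fin (w + 1) → Bool) (h c l s r),
    (∀ i, v (0, i) = enc (Sum.inl h) i) → (∀ i, v (1, i) = enc (Sum.inr c) i) →
    (∀ i, v (2, i) = enc l i) → (∀ i, v (3, i) = enc (Sum.inr s) i) →
    (∀ i, v (4, i) = enc (Sum.inr r) i) →
    ∀ j : Fin (w + 1), (step[j]'(by rw [length_step]; exact j.2)).eval v =
      enc (Sum.inr (A.bstep h c l.getRight? s r)) j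

theorem exists_formulas_of_fun {ι : Type} [Finite ι] {n : ℕ}
    (φ : (ι → Bool) → Fin n → Bool) : ∃ l : List (Formula ι), ∃ h : l.length = n,
    ∀ (v) (j : Fin n), (l[j]'(by rw [h]; exact j.2)).eval v = φ v j := by
  classical
  have := Fintype.ofFinite ι
  choose F hF using fun j => Formula.exists_eval_eq fun v => φ v j
  refine ⟨List.ofFn F, by simp, fun v j => ?_⟩
  simp [hF]

theorem exists_size_le {ι : Type} (l : List (Formula ι)) : ∃ B, ∀ F ∈ l, F.size ≤ B :=
  ⟨(l.map Formula.size).sum, fun _ hF => List.le_sum_of_mem (List.mem_map_of_mem hF)⟩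

/-- Cells are encoded one-hot, with an acceptance bit in front so that a single wire shows
acceptance. The encoding has a left inverse, so the transition becomes a Boolean function of the
bits of five cells, and every such function has a formula. -/
theorem nonempty_formulas : Nonempty A.Formulas := by
  classical
  have := A.finHd
  have := A.finBd
  obtain ⟨w, e⟩ : ∃ w, Nonempty (A.Cell ≃ Fin w) := Finite.exists_equiv_fin _
  obtain ⟨e⟩ := e
  let acc : A.Cell → Bool := Sum.elim A.accepts fun _ => false
  let enc : A.Cell → Fin (w + 1) → Bool := fun q => Fin.cons (acc q) fun i => decide (e q = i)
  have henc : Function.Injective enc := by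
    intro q q' h
    have := congrFun (Fin.cons_injective2 h).2 (e q)
    exact Eq.symm (by simpa using this.symm)
  let dec : (Fin (w + 1) → Bool) → A.Cell :=
    if h : Nonempty A.Cell then fun u => @Function.invFun _ _ h enc u else fun _ => Sum.inr A.blank
  have hdec : ∀ q, dec (enc q) = q := by
    intro q
    have h : Nonempty A.Cell := ⟨q⟩
    simp only [dec, dif_pos h]
    exact Function.leftInverse_invFun henc q
  -- The cell's own contents tell whether it is the head or a body cell, so one list of formulas
  -- serves for both. Other combinations of cells are irrelevant.
  let F : A.Cell → A.Cell → A.Cell → A.Cell → A.Cell → A.Cell := fun c₀ c₁ l s r =>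
    match c₀, c₁, s, r with
    | .inl h, .inr c, .inl _, _ => .inl (A.hstep h c)
    | .inl h, .inr c, .inr s, .inr r => .inr (A.bstep h c l.getRight? s r)
    | c₀, _, _, _ => c₀
  obtain ⟨ls, hs, es⟩ := exists_formulas_of_fun fun v : Fin 5 × Fin (w + 1) → Bool =>
    enc (F (dec fun i => v (0, i)) (dec fun i => v (1, i)) (dec fun i => v (2, i))
      (dec fun i => v (3, i)) (dec fun i => v (4, i)))
  obtain ⟨lh, hh, eh⟩ := exists_formulas_of_fun fun z => enc (Sum.inl (A.head z))
  obtain ⟨lc, hc, ec⟩ := exists_formulas_of_fun fun u => enc (Sum.inr (A.col u))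
  obtain ⟨B₁, h₁⟩ := exists_size_le ls
  obtain ⟨B₂, h₂⟩ := exists_size_le lh
  obtain ⟨B₃, h₃⟩ := exists_size_le lc
  refine ⟨⟨w, enc, fun h => rfl, B₁ + B₂ + B₃ + 1, by omega, ls, lh, lc, hs, hh, hc,
    fun F hF => (h₁ F hF).trans (by omega), fun F hF => (h₂ F hF).trans (by omega),
    fun F hF => (h₃ F hF).trans (by omega), eh, ec, ?_, ?_⟩⟩
  · intro v h c e0 e1 e3 j
    rw [es, funext e0, funext e1, funext e3, hdec, hdec]
  · intro v h c l s r e0 e1 e2 e3 e4 j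
    rw [es, funext e0, funext e1, funext e2, funext e3, funext e4, hdec, hdec, hdec, hdec, hdec]

end Automaton

end CircuitCounting

namespace CircuitCounting
open Function (update)

/-! ### The tableau of an automaton as a circuit -/

/-- Constant gates read no wires, so a cell with fixed contents is the same list of gates at every
position. -/
theorem Formula.block_const {ι : Type} (inp : ι → ℕ) (B : ℕ) (l : List Bool) (base base' : ℕ) :
    Formula.block inp B (l.map .const) base = Formula.block inp B (l.map .const) base' := by
  induction l generalizing base base' with
  | nil => rfl
  | cons b l ih => exact congrArg₂ (· ++ ·) rfl (ih _ _)

namespace Automaton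

variable {A : Automaton} (D : A.Formulas) (s T : Polynomial ℕ)

namespace Formulas

/-- The number of gates for a cell. -/
def cellSize : ℕ := (D.w + 1) * D.bound

/-- The number of inputs of the circuit for strings of length `n`. -/
noncomputable def arity (n : ℕ) : ℕ := (fun _ : A.Formulas => A.sel + s.eval n * A.width) D

/-- The number of cells in a row. -/
noncomputable def rowSize (n : ℕ) : ℕ :=
  (fun _ : A.Formulas => 1 + (2 * n + 2) + s.eval n + (T.eval n + 1)) D

/-- The wire that carries bit `i` of cell number `L`. -/
noncomputable def wire (n L i : ℕ) : ℕ := D.arity s n + D.cellSize * L + (i * D.bound + (D.bound - 1))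

/-- Gates for a cell with fixed contents. -/
def fixedGates (q : A.Cell) : List Gate :=
  Formula.block (fun e : Empty => e.elim) D.bound ((List.ofFn (D.enc q)).map .const) 0

/-- Gates for the initial head cell. -/
noncomputable def headGates (n : ℕ) : List Gate :=
  Formula.block (fun i : Fin A.sel => (i : ℕ)) D.bound D.head (D.arity s n + D.cellSize)

/-- Gates for the initial cell with column `j`. -/
noncomputable def colGates (n j : ℕ) : List Gate :=
  Formula.block (fun i : Fin A.width => A.sel + A.width * j + i) D.bound D.col
    (D.arity s n + D.cellSize * (1 + (1 + (2 * n + 2) + j)))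

/-- The numbers of the cells that are read by the cell `j` after step `t`. -/
noncomputable def source (n t j : ℕ) : Fin 5 → ℕ :=
  -- Cell `j` of row `t` has number `1 + t * rowSize + j`. The entries are the head, the first body
  -- cell, and the left neighbour, the cell itself and the right neighbour; the offset `1` avoids
  -- subtraction for the left neighbour.
  ![1 + t * D.rowSize s T n, 2 + t * D.rowSize s T n, t * D.rowSize s T n + j,
    t * D.rowSize s T n + j + 1, t * D.rowSize s T n + j + 2]

/-- Gates for the cell `j` after step `t`. -/
noncomputable def stepGates (n t j : ℕ) : List Gate :=
  Formula.block (fun p : Fin 5 × Fin (D.w + 1) => D.wire s n (D.source s T n t j p.1) p.2) D.bound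
    D.step (D.arity s n + D.cellSize * (1 + (t + 1) * D.rowSize s T n + j))

/-- Gates for the initial row. -/
noncomputable def initGates (x : List Bool) : List Gate :=
  -- Cell number `0` is a dummy that belongs to no row; it serves as the left neighbour of the first
  -- head cell.
  D.fixedGates (Sum.inr A.blank) ++ D.headGates s x.length ++
    (pairPrefix x).flatMap (fun b => D.fixedGates (Sum.inr (A.letter b))) ++
    (List.range (s.eval x.length)).flatMap (D.colGates s x.length) ++
    (List.range (T.eval x.length + 1)).flatMap (fun _ => D.fixedGates (Sum.inr A.blank))

/-- All gates. -/
noncomputable def gates (x : List Bool) : List Gate :=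
  D.initGates s T x ++ (List.range (T.eval x.length)).flatMap fun t =>
    (List.range (D.rowSize s T x.length)).flatMap (D.stepGates s T x.length t)

/-- The output wire. -/
noncomputable def output (n : ℕ) : ℕ := D.wire s n (1 + T.eval n * D.rowSize s T n) 0

/-! #### Correctness -/

/-- The wires `W` carry the contents `q` in cell number `L`. -/
def Carries (n : ℕ) (W : List Bool) (L : ℕ) (q : A.Cell) : Prop :=
  ∀ i : Fin (D.w + 1), W.getD (D.wire s n L i) false = D.enc q i

theorem wire_lt {n L L' : ℕ} (h : L < L') (i : Fin (D.w + 1)) :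
    D.wire s n L i < D.arity s n + D.cellSize * L' := by
  have h1 := D.bound_pos
  have h2 : (i : ℕ) * D.bound + (D.bound - 1) < D.cellSize := by
    have := Nat.mul_le_mul_right D.bound (show (i : ℕ) + 1 ≤ D.w + 1 by omega)
    rw [Nat.succ_mul] at this
    rw [cellSize]
    omega
  have h3 := Nat.mul_le_mul_left D.cellSize (show L + 1 ≤ L' by omega)
  rw [Nat.mul_succ] at h3
  rw [wire]
  omega

section Correctness

variable {s T}

/-- The selector bits in a list of inputs. -/
def selector (A : Automaton) (W : List Bool) : Fin A.sel → Bool := fun i => W.getD i false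

/-- The columns in a list of inputs. -/
def columns (A : Automaton) (W : List Bool) (j : ℕ) : Fin A.width → Bool :=
  fun i => W.getD (A.sel + A.width * j + i) false

variable (s T) in
/-- The gates `gs` are the first `L` cells of the tableau and carry the right contents except
outside the light cone. -/
structure Correct (x W₀ : List Bool) (gs : List Gate) (L : ℕ) : Prop where
  length : gs.length = D.cellSize * L
  wellFormed : WellFormed (D.arity s x.length) gs
  carries : ∀ t j, j < D.rowSize s T x.length → 1 + t * D.rowSize s T x.length + j < L →
    j + t < D.rowSize s T x.length → D.Carries s x.length (run W₀ gs)
      (1 + t * D.rowSize s T x.length + j)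
      (A.cell x (s.eval x.length) (selector A W₀) (columns A W₀) t j)

variable {D} {x W₀ : List Bool} (hW₀ : W₀.length = D.arity s x.length)

include hW₀ in
theorem Correct.append {gs g : List Gate} {L : ℕ} (h : D.Correct s T x W₀ gs L)
    (hg : g.length = D.cellSize)
    (hw : WellFormed (D.arity s x.length + D.cellSize * L) g)
    (hc : ∀ t j, j < D.rowSize s T x.length → 1 + t * D.rowSize s T x.length + j = L →
      j + t < D.rowSize s T x.length → D.Carries s x.length (run (run W₀ gs) g) L
      (A.cell x (s.eval x.length) (selector A W₀) (columns A W₀) t j)) :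
    D.Correct s T x W₀ (gs ++ g) (L + 1) where
  length := by rw [List.length_append, h.length, hg, Nat.mul_succ]
  wellFormed := by
    rw [wellFormed_append, h.length]
    exact ⟨h.wellFormed, hw⟩
  carries t j hj hL hjt := by
    rw [run_append]
    rcases Nat.lt_succ_iff_lt_or_eq.1 hL with hL | hL
    · intro i
      rw [getD_run_of_lt _ (by rw [length_run, h.length, hW₀]; exact D.wire_lt s hL i)]
      exact h.carries t j hj hL hjt i
    · have := hc t j hj hL hjt
      rwa [← hL] at this

theorem Correct.flatMap_range {gs : List Gate} {L : ℕ} (h : D.Correct s T x W₀ gs L)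
    (g : ℕ → List Gate) (n c : ℕ)
    (step : ∀ i < n, ∀ gs, D.Correct s T x W₀ gs (L + i * c) →
      D.Correct s T x W₀ (gs ++ g i) (L + (i + 1) * c)) :
    D.Correct s T x W₀ (gs ++ (List.range n).flatMap g) (L + n * c) := by
  induction n with
  | zero => simpa using h
  | succ n ih =>
    have := step n (by omega) _ (ih fun i hi => step i (by omega))
    simpa [List.range_succ, List.flatMap_append, List.append_assoc] using this

include hW₀ in
/-- Appending a block of gates for formulas. -/
theorem Correct.append_block {gs : List Gate} {L : ℕ} (h : D.Correct s T x W₀ gs L)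
    {ι : Type} (inp : ι → ℕ) {l : List (Formula ι)} (hl : l.length = D.w + 1)
    (hs : ∀ F ∈ l, F.size ≤ D.bound) (hinp : ∀ i, inp i < D.arity s x.length + D.cellSize * L)
    (hc : ∀ t j, j < D.rowSize s T x.length → 1 + t * D.rowSize s T x.length + j = L →
      j + t < D.rowSize s T x.length → ∀ i : Fin (D.w + 1),
        (l[i]'(by rw [hl]; exact i.2)).eval (fun a => (run W₀ gs).getD (inp a) false) =
        D.enc (A.cell x (s.eval x.length) (selector A W₀) (columns A W₀) t j) i) :
    D.Correct s T x W₀ (gs ++ Formula.block inp D.bound l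
      (D.arity s x.length + D.cellSize * L)) (L + 1) := by
  have hlen : (run W₀ gs).length = D.arity s x.length + D.cellSize * L := by
    rw [length_run, h.length, hW₀]
  refine h.append hW₀ (by rw [Formula.length_block inp hs, hl, cellSize])
    (Formula.wellFormed_block inp hs _ hinp) fun t j hj hL hjt i => ?_
  rw [← hc t j hj hL hjt i, ← hlen, wire, ← hlen]
  exact Formula.getD_run_block inp hs _ (by rwa [hlen]) (by rw [hl]; exact i.2)

include hW₀ in
theorem Correct.append_fixed {gs : List Gate} {L : ℕ} (h : D.Correct s T x W₀ gs L) (q : A.Cell)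
    (hc : ∀ t j, j < D.rowSize s T x.length → 1 + t * D.rowSize s T x.length + j = L →
      j + t < D.rowSize s T x.length →
        A.cell x (s.eval x.length) (selector A W₀) (columns A W₀) t j = q) :
    D.Correct s T x W₀ (gs ++ D.fixedGates q) (L + 1) := by
  rw [fixedGates, Formula.block_const _ _ _ 0 (D.arity s x.length + D.cellSize * L)]
  refine h.append_block hW₀ _ (by simp) (fun F hF => ?_) (fun e => e.elim)
    fun t j hj hL hjt i => ?_
  · obtain ⟨b, -, rfl⟩ := List.mem_map.1 hF
    exact D.bound_pos
  · rw [hc t j hj hL hjt]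
    change Formula.eval _ (((List.ofFn (D.enc q)).map Formula.const)[(i : ℕ)]'_) = _
    rw [List.getElem_map]
    simp only [List.getElem_ofFn]
    rfl

/-- Division with remainder: a cell number determines its row and its place in the row. -/
theorem eq_of_cell_eq {S t j t' j' : ℕ} (hj : j < S) (hj' : j' < S)
    (h : 1 + t * S + j = 1 + t' * S + j') : t = t' ∧ j = j' := by
  have h1 : t = t' := by
    have := congrArg (· / S) (show j + t * S = j' + t' * S by omega)
    simpa [Nat.add_mul_div_right _ _ (show 0 < S by omega), Nat.div_eq_of_lt hj,
      Nat.div_eq_of_lt hj'] using this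
  subst h1
  exact ⟨rfl, by omega⟩

theorem rowSize_eq (n : ℕ) :
    D.rowSize s T n = 1 + (2 * n + 2) + s.eval n + (T.eval n + 1) := rfl

theorem arity_eq (n : ℕ) : D.arity s n = A.sel + s.eval n * A.width := rfl

include hW₀ in
theorem correct_initGates :
    D.Correct s T x W₀ (D.initGates s T x) (1 + D.rowSize s T x.length) := by
  have h0 : D.Correct s T x W₀ [] 0 := ⟨by simp, trivial, fun t j _ h => by omega⟩
  have init : ∀ {L t j}, j < D.rowSize s T x.length → 1 + t * D.rowSize s T x.length + j = 1 + L →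
      L < D.rowSize s T x.length → t = 0 ∧ j = L := fun hj h hL =>
    eq_of_cell_eq hj hL (by omega)
  have h1 := h0.append_fixed hW₀ (Sum.inr A.blank) (fun t j _ h => by omega)
  have h2 : D.Correct s T x W₀ (D.fixedGates (Sum.inr A.blank) ++ D.headGates s x.length) 2 := by
    have := h1.append_block hW₀ (fun i : Fin A.sel => (i : ℕ)) D.length_head D.size_head
      (fun i => by have := i.2; simp only [arity_eq]; omega) (fun t j hj hL hjt i => ?_)
    · simpa [headGates] using this
    · obtain ⟨rfl, rfl⟩ := init (t := t) (L := 0) hj (by omega) (by omega)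
      have : (fun a : Fin A.sel => (run W₀ ([] ++ D.fixedGates (Sum.inr A.blank))).getD a false) =
          selector A W₀ := by
        funext a
        exact getD_run_of_lt _ (by have := a.2; simp only [hW₀, arity_eq]; omega)
      rw [this, D.eval_head]
      rfl
  have h3 : ∀ (l : List Bool) (gs : List Gate) (J : ℕ), D.Correct s T x W₀ gs (2 + J) →
      (pairPrefix x).drop J = l → D.Correct s T x W₀
        (gs ++ l.flatMap (fun b => D.fixedGates (Sum.inr (A.letter b)))) (2 + J + l.length) := by
    intro l
    induction l with
    | nil => intro gs J h _; simpa using h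
    | cons b l ih =>
      intro gs J h hl
      have hlen := congrArg List.length hl
      rw [List.length_drop, length_pairPrefix, List.length_cons] at hlen
      have hb : (pairPrefix x)[J]? = some b := by
        have := congrArg List.head? hl
        simpa [List.head?_drop] using this
      have h' := h.append_fixed hW₀ (Sum.inr (A.letter b)) (fun t j hj hL hjt => by
        obtain ⟨rfl, rfl⟩ := init (t := t) (L := 1 + J) hj (by omega) (by rw [rowSize_eq]; omega)
        rw [add_comm 1 J]
        simp only [cell, row, initBody]
        have : ((pairPrefix x).map A.letter)[J]? = some (A.letter b) := by simp [hb]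
        rw [List.getD_eq_getElem?_getD, List.getElem?_append_left
          (by simp only [List.length_map, length_pairPrefix]; omega), this]
        rfl)
      have := ih _ (J + 1) h' (by
        have := congrArg List.tail hl
        simpa using this)
      simp only [List.flatMap_cons, List.length_cons]
      rw [← List.append_assoc]
      convert this using 1
      omega
  have h3 := h3 (pairPrefix x) _ 0 h2 (by simp)
  rw [length_pairPrefix] at h3
  have h4 := h3.flatMap_range (D.colGates s x.length) (s.eval x.length) 1
    (fun i hi gs h => by
      rw [show 2 + 0 + (2 * x.length + 2) + i * 1 = 1 + (1 + (2 * x.length + 2) + i) by ring] at h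
      have hw : A.sel + A.width * (i + 1) ≤ D.arity s x.length := by
        have := Nat.mul_le_mul_left A.width (show i + 1 ≤ s.eval x.length by omega)
        rw [arity_eq, mul_comm (s.eval _)]
        omega
      rw [Nat.mul_succ] at hw
      have := h.append_block hW₀ (fun a : Fin A.width => A.sel + A.width * i + a) D.length_col
        D.size_col (fun a => by have := a.2; omega) (fun t j hj hL hjt a => ?_)
      · rw [colGates]
        convert this using 1
        ring
      · obtain ⟨rfl, rfl⟩ := init (t := t) (L := 1 + (2 * x.length + 2) + i) hj (by omega)
          (by rw [rowSize_eq]; omega)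
        have e : (fun a : Fin A.width => (run W₀ gs).getD (A.sel + A.width * i + a) false) =
            columns A W₀ i := by
          funext a
          exact getD_run_of_lt _ (by have := a.2; omega)
        rw [e, D.eval_col]
        have hrow : A.cell x (s.eval x.length) (selector A W₀) (columns A W₀) 0
            (1 + (2 * x.length + 2) + i) = Sum.inr (A.col (columns A W₀ i)) := by
          rw [show 1 + (2 * x.length + 2) + i = (2 * x.length + 2 + i) + 1 by ring]
          simp only [cell, row, initBody]
          rw [List.getD_append_right _ _ _ _
            (by simp only [List.length_map, length_pairPrefix]; omega)]
          simp [length_pairPrefix, hi]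
        rw [hrow])
  have h5 := h4.flatMap_range (fun _ => D.fixedGates (Sum.inr A.blank)) (T.eval x.length + 1) 1
    (fun i hi gs h => by
      have := h.append_fixed hW₀ (Sum.inr A.blank) (fun t j hj hL hjt => ?_)
      · convert this using 1
        ring
      · obtain ⟨rfl, rfl⟩ := init (t := t) (L := 1 + (2 * x.length + 2) + s.eval x.length + i) hj (by omega)
          (by rw [rowSize_eq]; omega)
        rw [show 1 + (2 * x.length + 2) + s.eval x.length + i =
          (2 * x.length + 2 + s.eval x.length + i) + 1 by ring]
        simp only [cell, row, initBody]
        rw [List.getD_eq_default _ _ (by simp [length_pairPrefix])])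
  rw [initGates]
  convert h5 using 1
  rw [rowSize_eq]
  ring

include hW₀ in
-- The last cell of a row takes the head of the next row for its right neighbour and may become
-- wrong. Such errors move left by one cell per step, so cell `j` at time `t` is right as long as `j
-- + t` is less than the row size. Within this cone all cells that are read lie in the cone of the
-- previous row.
theorem correct_gates : D.Correct s T x W₀ (D.gates s T x)
    (1 + D.rowSize s T x.length + T.eval x.length * D.rowSize s T x.length) := by
  refine (correct_initGates hW₀).flatMap_range _ _ _ fun t ht gs h => ?_
  have hS : 5 ≤ D.rowSize s T x.length + 1 := by rw [rowSize_eq]; omega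
  have := h.flatMap_range (D.stepGates s T x.length t) (D.rowSize s T x.length) 1
    fun J hJ gs h => ?_
  · convert this using 1
    ring
  · have e : 1 + D.rowSize s T x.length + t * D.rowSize s T x.length + J * 1 = 1 + (t + 1) * D.rowSize s T x.length + J := by ring
    rw [e] at h
    have hts : (t + 1) * D.rowSize s T x.length = t * D.rowSize s T x.length + D.rowSize s T x.length := by ring
    have hsrc : ∀ r, D.source s T x.length t J r < 1 + (t + 1) * D.rowSize s T x.length + J := by
      intro r
      fin_cases r <;> simp [source] <;> omega
    have := h.append_block hW₀ (fun p : Fin 5 × Fin (D.w + 1) =>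
      D.wire s x.length (D.source s T x.length t J p.1) p.2) D.length_step D.size_step
      (fun p => D.wire_lt s (hsrc p.1) p.2) (fun t' j hj hL hjt i => ?_)
    · rw [stepGates]
      convert this using 1
      ring
    · obtain ⟨rfl, rfl⟩ := eq_of_cell_eq hj hJ hL
      have c0 := h.carries t 0 (by omega) (by omega) (by omega)
      have c1 := h.carries t 1 (by omega) (by omega) (by omega)
      have c3 := h.carries t j (by omega) (by omega) (by omega)
      cases j with
      -- The left neighbour of the head is the dummy or the end of the previous row;
      -- `eval_step_head` assumes nothing about it or about the right neighbour.
      | zero =>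
        refine D.eval_step_head _ (A.row x (s.eval x.length) (selector A W₀) (columns A W₀) t).1
          ((A.row x (s.eval x.length) (selector A W₀) (columns A W₀) t).2 0) ?_ ?_ ?_ i
        · intro i
          simpa [source, cell] using c0 i
        · intro i
          have := c1 i
          rw [show 1 + t * D.rowSize s T x.length + 1 = 2 + t * D.rowSize s T x.length by ring] at this
          simpa [source, cell] using this
        · intro i
          have := c3 i
          rw [show 1 + t * D.rowSize s T x.length + 0 = t * D.rowSize s T x.length + 1 by ring] at this
          simpa [source, cell] using this
      | succ j =>
        have c2 := h.carries t j (by omega) (by omega) (by omega)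
        have c4 := h.carries t (j + 2) (by omega) (by omega) (by omega)
        have := D.eval_step_body (fun p => (run W₀ gs).getD
            (D.wire s x.length (D.source s T x.length t (j + 1) p.1) p.2) false)
          (A.row x (s.eval x.length) (selector A W₀) (columns A W₀) t).1
          ((A.row x (s.eval x.length) (selector A W₀) (columns A W₀) t).2 0)
          (A.cell x (s.eval x.length) (selector A W₀) (columns A W₀) t j)
          ((A.row x (s.eval x.length) (selector A W₀) (columns A W₀) t).2 j)
          ((A.row x (s.eval x.length) (selector A W₀) (columns A W₀) t).2 (j + 1)) ?_ ?_ ?_ ?_ ?_ i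
        · rw [this]
          cases j <;> rfl
        · intro i
          simpa [source, cell] using c0 i
        · intro i
          have := c1 i
          rw [show 1 + t * D.rowSize s T x.length + 1 = 2 + t * D.rowSize s T x.length by ring] at this
          simpa [source, cell] using this
        · intro i
          have := c2 i
          rw [show 1 + t * D.rowSize s T x.length + j = t * D.rowSize s T x.length + (j + 1) by ring] at this
          simpa [source] using this
        · intro i
          have := c3 i
          rw [show 1 + t * D.rowSize s T x.length + (j + 1) = t * D.rowSize s T x.length + (j + 1) + 1 by ring] at this
          simpa [source, cell] using this
        · intro i
          have := c4 i
          rw [show 1 + t * D.rowSize s T x.length + (j + 2) = t * D.rowSize s T x.length + (j + 1) + 2 by ring] at this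
          simpa [source, cell] using this

end Correctness

/-- The tableau as a circuit. -/
noncomputable def circuit (x : List Bool) : Circuit where
  arity := D.arity s x.length
  gates := D.gates s T x
  output := D.output s T x.length
  -- The shape of the gates does not depend on the input values, so any list of the right length
  -- will do.
  wellFormed := (correct_gates (W₀ := List.replicate _ false) List.length_replicate).wellFormed
  output_lt := by
    rw [(correct_gates (T := T) (W₀ := List.replicate _ false) List.length_replicate).length]
    refine D.wire_lt s ?_ 0
    have : 0 < D.rowSize s T x.length := by rw [rowSize_eq]; omega
    omega

/-- The output wire is the acceptance bit of the head at the last time, which is in the cone because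
a row has more cells than there are steps. -/
theorem eval_circuit (x : List Bool) (X : Fin (D.circuit s T x).arity → Bool) :
    (D.circuit s T x).eval X = A.accepts (A.row x (s.eval x.length) (selector A (List.ofFn X))
      (columns A (List.ofFn X)) (T.eval x.length)).1 := by
  have hS : T.eval x.length < D.rowSize s T x.length := by rw [rowSize_eq]; omega
  have h := (correct_gates (D := D) (s := s) (T := T) (x := x) (W₀ := List.ofFn X)
    (List.length_ofFn)).carries (T.eval x.length) 0 (by omega) (by omega) (by omega) 0
  rw [← D.enc_head]
  exact h

end Formulas
end Automaton

end CircuitCounting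

namespace CircuitCounting
open Function (update)

/-! ### Polynomial-time generation of the tableau circuit -/

namespace Automaton.Formulas

variable {A : Automaton} (D : A.Formulas) (s T : Polynomial ℕ) {d : ℕ} {f g h : (ℕ → ℕ) → ℕ}

theorem isExpr_arity (hf : IsExpr d f) : IsExpr d fun env => D.arity s (f env) :=
  (IsExpr.const _).add ((hf.polynomial s).mul (.const _))

theorem isExpr_rowSize (hf : IsExpr d f) : IsExpr d fun env => D.rowSize s T (f env) :=
  (((IsExpr.const 1).add (((IsExpr.const 2).mul hf).add (.const 2))).add (hf.polynomial s)).add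
    ((hf.polynomial T).add (.const 1))

theorem isExpr_wire (hf : IsExpr d f) (hg : IsExpr d g) (i : ℕ) :
    IsExpr d fun env => D.wire s (f env) (g env) i :=
  ((D.isExpr_arity s hf).add ((IsExpr.const _).mul hg)).add (.const _)

theorem isExpr_source (hf : IsExpr d f) (hg : IsExpr d g) (hh : IsExpr d h) (r : Fin 5) :
    IsExpr d fun env => D.source s T (f env) (g env) (h env) r := by
  have hS := hg.mul (D.isExpr_rowSize s T hf)
  fin_cases r
  · exact (IsExpr.const 1).add hS
  · exact (IsExpr.const 2).add hS
  · exact hS.add hh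
  · exact (hS.add hh).add (.const 1)
  · exact (hS.add hh).add (.const 2)

theorem emitsGates_initGates : EmitsGates 1 fun x env =>
    D.fixedGates (Sum.inr A.blank) ++ D.headGates s (env 0) ++
    (pairPrefix x).flatMap (fun b => D.fixedGates (Sum.inr (A.letter b))) ++
    (List.range (s.eval (env 0))).flatMap (D.colGates s (env 0)) ++
    (List.range (T.eval (env 0) + 1)).flatMap (fun _ => D.fixedGates (Sum.inr A.blank)) := by
  have h0 : ∀ d, IsExpr (d + 1) fun env => env 0 := fun d => IsExpr.var d.succ_pos
  have h1 : IsExpr 2 fun env => env 1 := IsExpr.var one_lt_two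
  have head : EmitsGates 1 fun x env => D.headGates s (env 0) :=
    EmitsGates.block D.bound (inp := fun _ (i : Fin A.sel) => (i : ℕ)) (fun i => IsExpr.const _) D.head
      ((D.isExpr_arity s (h0 0)).add (.const _))
  have pre : EmitsGates 1 fun x env => (pairPrefix x).flatMap
      (fun b => D.fixedGates (Sum.inr (A.letter b))) := by
    have := (EmitsGates.bits (d := 1) fun b => [b, b].flatMap
      fun b => D.fixedGates (Sum.inr (A.letter b))).append (.fixed ([false, true].flatMap
      fun b => D.fixedGates (Sum.inr (A.letter b))))
    simpa only [pairPrefix, List.flatMap_append, List.flatMap_assoc] using this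
  have col : EmitsGates 1 fun x env =>
      (List.range (s.eval (env 0))).flatMap (D.colGates s (env 0)) := by
    have := EmitsGates.loop ((h0 0).polynomial s) (EmitsGates.block D.bound
      (inp := fun env (i : Fin A.width) => A.sel + A.width * env 1 + i)
      (base := fun env => D.arity s (env 0) +
        D.cellSize * (1 + (1 + (2 * env 0 + 2) + env 1)))
      (fun i => ((IsExpr.const _).add ((IsExpr.const _).mul h1)).add (.const _)) D.col
      ((D.isExpr_arity s (h0 1)).add ((IsExpr.const _).mul ((IsExpr.const 1).add
        (((IsExpr.const 1).add (((IsExpr.const 2).mul (h0 1)).add (.const 2))).add h1)))))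
    simp only [Function.update_self] at this
    exact this
  have blanks : EmitsGates 1 fun x env => (List.range (T.eval (env 0) + 1)).flatMap
      (fun _ => D.fixedGates (Sum.inr A.blank)) :=
    EmitsGates.loop (((h0 0).polynomial T).add (.const 1)) (.fixed _)
  exact ((((EmitsGates.fixed _).append head).append pre).append col).append blanks

/-- The formulas are fixed and their wires are expressions in the input length, the time and the
place, held in counters `0`, `1` and `2`; two nested loops emit all rows. -/
theorem emitsGates_stepGates : EmitsGates 1 fun _ env =>
    (List.range (T.eval (env 0))).flatMap fun t =>
      (List.range (D.rowSize s T (env 0))).flatMap (D.stepGates s T (env 0) t) := by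
  have h0 : ∀ d, IsExpr (d + 1) fun env => env 0 := fun d => IsExpr.var d.succ_pos
  have h1 : ∀ d, IsExpr (d + 2) fun env => env 1 := fun d => IsExpr.var (by omega)
  have h2 : IsExpr 3 fun env => env 2 := IsExpr.var (by omega)
  have := EmitsGates.loop ((h0 0).polynomial T) (EmitsGates.loop (D.isExpr_rowSize s T (h0 1))
    (EmitsGates.block D.bound
      (inp := fun env (p : Fin 5 × Fin (D.w + 1)) =>
        D.wire s (env 0) (D.source s T (env 0) (env 1) (env 2) p.1) p.2)
      (base := fun env => D.arity s (env 0) +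
        D.cellSize * (1 + (env 1 + 1) * D.rowSize s T (env 0) + env 2))
      (fun p => D.isExpr_wire s (h0 2) (D.isExpr_source s T (h0 2) (h1 1) h2 p.1) _) D.step
      ((D.isExpr_arity s (h0 2)).add ((IsExpr.const _).mul (((IsExpr.const 1).add
        (((h1 1).add (.const 1)).mul (D.isExpr_rowSize s T (h0 2)))).add h2)))))
  simp only [Function.update_self,
    Function.update_of_ne (show (0 : ℕ) ≠ 2 by omega)] at this
  exact this

/-- The code of the tableau circuit can be computed in polynomial time. -/
theorem encode_circuit_mem_FP : (fun x => (D.circuit s T x).encode) ∈ FP := by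
  have h0 : IsExpr 1 fun env => env 0 := IsExpr.var Nat.one_pos
  have hout : IsExpr 1 fun env => D.output s T (env 0) :=
    D.isExpr_wire s h0 ((IsExpr.const 1).add ((h0.polynomial T).mul (D.isExpr_rowSize s T h0))) 0
  have := (((Emits.unary (D.isExpr_arity s h0)).append
    (Emits.append ((D.emitsGates_initGates s T).append (D.emitsGates_stepGates s T))
      (Emits.lit [false]))).append (Emits.unary hout)).mem_FP
  convert this using 2 with x
  rw [Circuit.encode, encodeGates_eq]
  simp only [Function.update_self]
  rfl

end Automaton.Formulas

end CircuitCounting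

namespace CircuitCounting
open Function (update)

/-! ### Parallel simulation of several runs of a stack machine -/

namespace StackMachine

variable (M : StackMachine)

theorem run_succ (w : List Bool) (t : ℕ) : M.run w (t + 1) = M.step (M.run w t) :=
  Function.iterate_succ_apply' _ _ _

open Classical in
/-- The automaton that runs `M` on the pairs `⟨x, y i⟩` for the rows `y i` of a matrix. Moreover it
folds the columns of the matrix by `δ`. -/
noncomputable def simulator (k b : ℕ) {Q : Type} [Finite Q] (q₀ : Q) (δ : (Fin k → Bool) → Q → Q)
    (acc : (Fin b → Bool) → Q → (Fin k → Bool) → Bool) : Automaton where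
  Hd := (Fin k → M.State) × (Fin b → Bool) × Bool
  Bd := (Fin k → M.Stk → Option M.Sym) × Option (Fin k → Bool) × Q
  finHd := have := M.finState; inferInstance
  finBd := by
    have := M.finSym
    have := M.finStk
    have : Finite (Option M.Sym) := inferInstance
    infer_instance
  hstep h c := (fun i => (M.delta (h.1 i) (c.1 i)).1, h.2.1,
    acc h.2.1 c.2.2 fun i => M.accepts (c.1 i M.output))
  bstep h c l s r := (fun i κ => match (M.delta (h.1 i) (c.1 i)).2 κ with
      | .stay => s.1 i κ
      | .pop => r.1 i κ
      | .push a => l.elim (some a) fun l => l.1 i κ,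
    s.2.1, s.2.1.elim id δ r.2.2)
  accepts h := h.2.2
  sel := b
  width := k
  head z := (fun _ => M.start, z, false)
  col u := (fun i κ => if κ = M.input then some (M.code (u i)) else none, some u, q₀)
  letter a := (fun _ κ => if κ = M.input then some (M.code a) else none, none, q₀)
  blank := (fun _ _ => none, none, q₀)

variable {k b : ℕ} {Q : Type} [Finite Q] (q₀ : Q) (δ : (Fin k → Bool) → Q → Q)
  (acc : (Fin b → Bool) → Q → (Fin k → Bool) → Bool) (x : List Bool) (m : ℕ)
  (z : Fin b → Bool) (u : ℕ → Fin k → Bool)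

theorem simulator_initBody : (M.simulator k b q₀ δ acc).initBody x m u =
    (pairPrefix x).map (M.simulator k b q₀ δ acc).letter ++
      (List.range m).map fun j => (M.simulator k b q₀ δ acc).col (u j) := rfl

open Classical in
-- The body cell at place `j` holds the entries at depth `j` of all stacks in all runs. The head
-- shows the states and the first body cell the tops of the stacks, so every cell can work out the
-- action on each stack and shift accordingly: from the right for a pop, from the left for a push,
-- where the first cell takes the new symbol.
theorem simulator_run (i : Fin k) (t : ℕ) :
    ((M.simulator k b q₀ δ acc).row x m z u t).1.1 i =
      (M.run (pair x ((List.range m).map fun j => u j i)) t).1 ∧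
    ∀ j κ, (((M.simulator k b q₀ δ acc).row x m z u t).2 j).1 i κ =
      ((M.run (pair x ((List.range m).map fun j => u j i)) t).2 κ)[j]? := by
  induction t with
  | zero =>
    refine ⟨rfl, fun j κ => ?_⟩
    change (((M.simulator k b q₀ δ acc).initBody x m u).getD j
      (M.simulator k b q₀ δ acc).blank).1 i κ = (if κ = M.input then _ else _)[j]?
    have e : ∀ l : List (M.simulator k b q₀ δ acc).Bd,
        (l.getD j (M.simulator k b q₀ δ acc).blank).1 i κ = (l.map fun c => c.1 i κ)[j]?.join := by
      intro l
      rw [List.getD_eq_getElem?_getD, List.getElem?_map]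
      cases l[j]? <;> rfl
    rw [e, simulator_initBody, pair_eq, List.map_append, List.map_map, List.map_map]
    by_cases hκ : κ = M.input
    · rw [if_pos hκ, List.map_append, List.map_map]
      have : ∀ l : List M.Sym, (l.map some)[j]?.join = l[j]? := by
        intro l
        rw [List.getElem?_map]
        cases l[j]? <;> rfl
      rw [← this, List.map_append, List.map_map, List.map_map]
      congr 3 <;> refine List.map_congr_left fun a _ => ?_ <;> exact if_pos hκ
    · rw [if_neg hκ]
      have : ∀ l : List (Option M.Sym), (∀ a ∈ l, a = none) → l[j]?.join = none := by
        intro l hl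
        cases h : l[j]? with
        | none => rfl
        | some a => exact hl a (List.mem_of_getElem? h)
      rw [this]
      · rfl
      · intro a ha
        rcases List.mem_append.1 ha with ha | ha <;> obtain ⟨c, -, rfl⟩ := List.mem_map.1 ha <;>
          exact if_neg hκ
  | succ t ih =>
    rw [run_succ]
    obtain ⟨ih1, ih2⟩ := ih
    have h0 : (((M.simulator k b q₀ δ acc).row x m z u t).2 0).1 i = fun κ =>
        ((M.run (pair x ((List.range m).map fun j => u j i)) t).2 κ).head? := by
      funext κ
      rw [ih2, List.head?_eq_getElem?]
    refine ⟨congrArg Prod.fst (congrArg₂ M.delta ih1 h0), fun j κ => ?_⟩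
    have e := congrArg (fun r => r.2 κ) (congrArg₂ M.delta ih1 h0)
    change (match (M.delta (((M.simulator k b q₀ δ acc).row x m z u t).1.1 i)
      ((((M.simulator k b q₀ δ acc).row x m z u t).2 0).1 i)).2 κ with
      | .stay => (((M.simulator k b q₀ δ acc).row x m z u t).2 j).1 i κ
      | .pop => (((M.simulator k b q₀ δ acc).row x m z u t).2 (j + 1)).1 i κ
      | .push a => Option.elim (j.casesOn none fun j =>
          some (((M.simulator k b q₀ δ acc).row x m z u t).2 j)) (some a) fun l => l.1 i κ) = _
    refine Eq.trans (congrArg (fun r : StackAct M.Sym => (match r with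
      | .stay => (((M.simulator k b q₀ δ acc).row x m z u t).2 j).1 i κ
      | .pop => (((M.simulator k b q₀ δ acc).row x m z u t).2 (j + 1)).1 i κ
      | .push a => Option.elim (j.casesOn none fun j =>
          some (((M.simulator k b q₀ δ acc).row x m z u t).2 j)) (some a) fun l => l.1 i κ)) e) ?_
    rw [step]
    dsimp only
    cases (M.delta (M.run (pair x ((List.range m).map fun j => u j i)) t).1 fun κ =>
      ((M.run (pair x ((List.range m).map fun j => u j i)) t).2 κ).head?).2 κ with
    | stay => exact ih2 j κ
    | pop => exact (ih2 (j + 1) κ).trans List.getElem?_tail.symm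
    | push a =>
      cases j with
      | zero => rfl
      | succ j => exact ih2 j κ

/-- Each cell applies its column to the value that its right neighbour had one step earlier, so at
time `t` it has folded the next `t` cells. Cells without a column pass the value on unchanged. -/
theorem simulator_fold (t j : ℕ) :
    (((M.simulator k b q₀ δ acc).row x m z u t).2 j).2 =
      ((((M.simulator k b q₀ δ acc).initBody x m u).getD j
        (M.simulator k b q₀ δ acc).blank).2.1,
      ((((M.simulator k b q₀ δ acc).initBody x m u).drop j).take t).foldr
        (fun c => c.2.1.elim id δ) q₀) := by
  induction t generalizing j with
  | zero =>
    change (((M.simulator k b q₀ δ acc).initBody x m u).getD j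
      (M.simulator k b q₀ δ acc).blank).2 = _
    have : ∀ l : List (M.simulator k b q₀ δ acc).Bd, (∀ c ∈ l, c.2.2 = q₀) →
        (l.getD j (M.simulator k b q₀ δ acc).blank).2.2 = q₀ := by
      intro l hl
      rw [List.getD_eq_getElem?_getD]
      cases h : l[j]? with
      | none => rfl
      | some a => exact hl a (List.mem_of_getElem? h)
    refine Prod.ext rfl (this _ fun c hc => ?_)
    rcases List.mem_append.1 hc with ha | ha <;> obtain ⟨c, -, rfl⟩ := List.mem_map.1 ha <;> rfl
  | succ t ih =>
    change ((((M.simulator k b q₀ δ acc).row x m z u t).2 j).2.1,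
      (((M.simulator k b q₀ δ acc).row x m z u t).2 j).2.1.elim id δ
        (((M.simulator k b q₀ δ acc).row x m z u t).2 (j + 1)).2.2) = _
    rw [ih, ih]
    refine Prod.ext rfl ?_
    generalize (M.simulator k b q₀ δ acc).initBody x m u = l
    by_cases hj : j < l.length
    · rw [List.drop_eq_getElem_cons hj, List.take_succ_cons, List.foldr_cons,
        List.getD_eq_getElem _ _ hj]
    · rw [List.drop_eq_nil_of_le (by omega), List.drop_eq_nil_of_le (by omega),
        List.getD_eq_default _ _ (by omega)]
      simp
      rfl

/-- By time `t` the fold has reached the first body cell from the far end of the input and all runs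
have decided; one more step lets the head record the verdict. -/
theorem simulator_accepts {R : Lang} {p : Polynomial ℕ}
    (hp : ∀ (w : List Bool) (t : ℕ), p.eval w.length ≤ t →
      (M.accepts ((M.run w t).2 M.output).head? = true ↔ w ∈ R)) {t : ℕ}
    (h₁ : 2 * x.length + 2 + m ≤ t) (h₂ : p.eval (2 * x.length + 2 + m) ≤ t) (r : Fin k → Bool)
    (hr : ∀ i, r i = true ↔ pair x ((List.range m).map fun j => u j i) ∈ R) :
    (M.simulator k b q₀ δ acc).accepts ((M.simulator k b q₀ δ acc).row x m z u (t + 1)).1 =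
      acc z (((List.range m).map u).foldr δ q₀) r := by
  have hz : ∀ t, ((M.simulator k b q₀ δ acc).row x m z u t).1.2.1 = z := by
    intro t
    induction t with
    | zero => rfl
    | succ t ih => exact ih
  have hf := congrArg Prod.snd (M.simulator_fold q₀ δ acc x m z u t 0)
  rw [List.drop_zero, List.take_of_length_le (by simpa [simulator_initBody, length_pairPrefix] using h₁), simulator_initBody,
    List.foldr_append, List.foldr_map, List.foldr_map] at hf
  have e : ∀ (l : List Bool) (q : Q), l.foldr (fun a => Option.elim
      ((M.simulator k b q₀ δ acc).letter a).2.1 id δ) q = q := by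
    intro l q
    induction l with
    | nil => rfl
    | cons a l ih => exact ih
  change acc ((M.simulator k b q₀ δ acc).row x m z u t).1.2.1
    (((M.simulator k b q₀ δ acc).row x m z u t).2 0).2.2 _ = _
  rw [hz, hf, List.foldr_map]
  refine congrArg₂ _ (e _ _) (funext fun i => ?_)
  rw [Bool.eq_iff_iff, hr, ← hp _ t (by simpa [pair_eq, length_pairPrefix] using h₂),
    (M.simulator_run q₀ δ acc x m z u i t).2, List.head?_eq_getElem?]

end StackMachine

end CircuitCounting

namespace CircuitCounting

/-! ### Increasing tuples -/

/-- An `a`-element subset of `W` has exactly one increasing enumeration, for the order pulled back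
along `g`. Fixing the entries from `a` on to `z` keeps them from being counted more than once. -/
theorem card_increasing_tuples {α β : Type} [Finite α] [LinearOrder β] {g : α → β}
    (hg : Function.Injective g) (W : Set α) (z : α) {a k : ℕ} (ha : a ≤ k) :
    Nat.card {Y : Fin k → α // (∀ i : Fin k, (i : ℕ) < a → Y i ∈ W) ∧
      (∀ i j : Fin k, i < j → (j : ℕ) < a → g (Y i) < g (Y j)) ∧
      ∀ i : Fin k, a ≤ i → Y i = z} = W.ncard.choose a := by
  classical
  have := Fintype.ofFinite α
  let _ : LinearOrder α := LinearOrder.lift' g hg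
  rw [Set.ncard_eq_toFinset_card', ← Finset.card_powersetCard, ← Nat.card_eq_finsetCard]
  have hS : ∀ S : Finset.powersetCard a W.toFinset, (↑S.1 : Set α) ⊆ W ∧ S.1.card = a := fun S =>
    (Finset.mem_powersetCard.1 S.2).imp_left fun h y hy => Set.mem_toFinset.1 (h hy)
  let F : Finset.powersetCard a W.toFinset → Fin k → α := fun S i =>
    if h : (i : ℕ) < a then S.1.orderEmbOfFin (hS S).2 ⟨i, h⟩ else z
  have hF : ∀ S (i : Fin k) (hi : (i : ℕ) < a),
      F S i = S.1.orderEmbOfFin (hS S).2 ⟨i, hi⟩ := fun S i hi => dif_pos hi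
  have hF' : ∀ S (i : Fin k), a ≤ i → F S i = z := fun S i hi => dif_neg (by omega)
  have hF'' : ∀ S, (∀ i : Fin k, (i : ℕ) < a → F S i ∈ W) ∧
      (∀ i j : Fin k, i < j → (j : ℕ) < a → g (F S i) < g (F S j)) ∧
      ∀ i : Fin k, a ≤ i → F S i = z := by
    refine fun S => ⟨fun i hi => ?_, fun i j hij hj => ?_, hF' S⟩
    · rw [hF S i hi]
      exact (hS S).1 (Finset.orderEmbOfFin_mem _ _ _)
    · have hi : (i : ℕ) < a := lt_trans hij hj
      rw [hF S i hi, hF S j hj]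
      exact (S.1.orderEmbOfFin (hS S).2).strictMono (show (⟨i, hi⟩ : Fin a) < ⟨j, hj⟩ from hij)
  refine (Nat.card_congr (Equiv.ofBijective (fun S => ⟨F S, hF'' S⟩)
    ⟨fun S S' h => ?_, ?_⟩)).symm
  · have h : F S = F S' := congrArg Subtype.val h
    have e : ⇑(S.1.orderEmbOfFin (hS S).2) = S'.1.orderEmbOfFin (hS S').2 := by
      funext i
      have := congrFun h ⟨i, i.2.trans_le ha⟩
      rwa [hF _ _ i.2, hF _ _ i.2] at this
    apply Subtype.ext
    rw [← Finset.coe_inj, ← Finset.range_orderEmbOfFin _ (hS S).2, e, Finset.range_orderEmbOfFin]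
  · rintro ⟨Y, h₁, h₂, h₃⟩
    let y : Fin a → α := fun i => Y ⟨i, i.2.trans_le ha⟩
    have hy : StrictMono y := fun i j hij => h₂ _ _ hij j.2
    have hc : (Finset.univ.image y).card = a := by
      rw [Finset.card_image_of_injective _ hy.injective, Finset.card_univ, Fintype.card_fin]
    refine ⟨⟨Finset.univ.image y, Finset.mem_powersetCard.2 ⟨fun v hv => ?_, hc⟩⟩,
      Subtype.ext (funext fun i => ?_)⟩
    · obtain ⟨i, -, rfl⟩ := Finset.mem_image.1 hv
      exact Set.mem_toFinset.2 (h₁ _ i.2)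
    · by_cases hi : (i : ℕ) < a
      · refine (hF _ i hi).trans ?_
        rw [← Finset.orderEmbOfFin_unique hc (fun i => Finset.mem_image_of_mem y (Finset.mem_univ i))
          hy]
      · exact (hF' _ i (by omega)).trans (h₃ i (by omega)).symm

/-! ### Comparison of strings bit by bit -/

/-- Comparisons of the rows of a matrix, updated when a column is added on the left: which rows
are smaller than which, and which rows are zero. -/
def compareStep {k : ℕ} (u : Fin k → Bool) (q : (Fin k → Fin k → Bool) × (Fin k → Bool)) :
    (Fin k → Fin k → Bool) × (Fin k → Bool) :=
  (fun i j => decide (u i < u j) || (u i == u j && q.1 i j), fun i => !u i && q.2 i)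

/-- Lexicographic order can be read from right to left with finite memory: a new leftmost column
decides the comparison unless its two bits agree. -/
theorem foldr_compareStep {k : ℕ} (us : List (Fin k → Bool)) :
    (∀ i j, (us.foldr compareStep (fun _ _ => false, fun _ => true)).1 i j = true ↔
      us.map (· i) < us.map (· j)) ∧
    ∀ i, (us.foldr compareStep (fun _ _ => false, fun _ => true)).2 i = true ↔
      ∀ u ∈ us, u i = false := by
  induction us with
  | nil => simp
  | cons u us ih =>
    refine ⟨fun i j => ?_, fun i => ?_⟩
    · simp [compareStep, ih.1, List.cons_lt_cons_iff]
    · simp [compareStep, ih.2]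

/-! ### Coefficients -/

/-- The system is triangular with ones on the diagonal. Each new coefficient is the gap from the
partial sum to a larger element of `B`; infinitude of `B` makes this gap a natural number. -/
theorem exists_coefficients {B : Set ℕ} (hB : B.Infinite) (a k : ℕ) :
    ∃ c : ℕ → ℕ, c 0 = a ∧ ∀ n, 0 < n → n ≤ k → ∑ i ∈ Finset.range (n + 1), c i * n.choose i ∈ B := by
  induction k with
  | zero => exact ⟨fun _ => a, rfl, fun n h h' => by omega⟩
  | succ k ih =>
    obtain ⟨c, h0, hc⟩ := ih
    obtain ⟨b, hb, hlt⟩ := hB.exists_gt (∑ i ∈ Finset.range (k + 1), c i * (k + 1).choose i)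
    refine ⟨Function.update c (k + 1) (b - ∑ i ∈ Finset.range (k + 1), c i * (k + 1).choose i),
      by simpa using h0, fun n hn hnk => ?_⟩
    have e : ∀ n ≤ k + 1, ∀ d N : ℕ, ∑ i ∈ Finset.range n, Function.update c (k + 1) d i * N.choose i =
        ∑ i ∈ Finset.range n, c i * N.choose i := fun n hn d N =>
      Finset.sum_congr rfl fun i hi => by
        rw [Function.update_of_ne (by have := Finset.mem_range.1 hi; omega)]
    rcases Nat.lt_or_eq_of_le hnk with h | rfl
    · rw [e _ (by omega)]
      exact hc n hn (by omega)
    · rw [Finset.sum_range_succ, e _ le_rfl, Function.update_self, Nat.choose_self, mul_one,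
        Nat.add_sub_cancel' hlt.le]
      exact hb

theorem sum_fin_choose (c : ℕ → ℕ) {n k : ℕ} (h : n ≤ k) :
    ∑ i : Fin (k + 1), c i * n.choose i = ∑ i ∈ Finset.range (n + 1), c i * n.choose i := by
  rw [Fin.sum_univ_eq_sum_range fun i => c i * n.choose i]
  refine (Finset.sum_subset (Finset.range_subset_range.2 (by omega)) fun i _ hi => ?_).symm
  rw [Nat.choose_eq_zero_of_lt (by simpa using hi), mul_zero]

/-! ### Circuits with a prescribed number of satisfying inputs -/

/-- The inputs are the tag followed by the matrix of `k` strings of length `m`, stored column by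
column as the automaton expects. -/
theorem card_inputs {b m k : ℕ} (Q : (Fin b → Bool) → (Fin k → Fin m → Bool) → Prop) :
    Nat.card {X : Fin (b + m * k) → Bool // Q (fun i => (List.ofFn X).getD i false)
      fun i j => (List.ofFn X).getD (b + k * j + i) false} =
    Nat.card {p : (Fin b → Bool) × (Fin k → Fin m → Bool) // Q p.1 p.2} := by
  let e : (Fin (b + m * k) → Bool) ≃ (Fin b → Bool) × (Fin k → Fin m → Bool) :=
    (finSumFinEquiv.symm.arrowCongr (Equiv.refl _)).trans ((Equiv.sumArrowEquivProdArrow _ _ _).trans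
      ((Equiv.refl _).prodCongr (((finProdFinEquiv.symm.trans (Equiv.prodComm _ _)).arrowCongr
        (Equiv.refl _)).trans (Equiv.curry _ _ _))))
  refine Nat.card_congr (e.subtypeEquiv fun X => ?_)
  have h : ∀ (n : ℕ) (hn : n < b + m * k), (List.ofFn X).getD n false = X ⟨n, hn⟩ := by
    intro n hn
    rw [List.getD_eq_getElem _ _ (by simpa using hn), List.getElem_ofFn]
  have e1 : (fun i : Fin b => (List.ofFn X).getD i false) = (e X).1 := by
    funext i
    exact h i (by have := i.2; omega)
  have e2 : (fun (i : Fin k) (j : Fin m) => (List.ofFn X).getD (b + k * j + i) false) = (e X).2 := by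
    funext i j
    refine (h _ (Fin.natAdd b (finProdFinEquiv (j, i))).2 |> Eq.trans (congrArg (List.getD _ · _) ?_)).trans ?_
    · simp [add_comm, add_left_comm]
    · rfl
  rw [e1, e2]

/-- Injectivity of `e` makes the cases for different tags disjoint; strings that are not tags
contribute nothing. -/
theorem card_exists_tag {S Z Y : Type} [Fintype S] [Finite Y] {e : S → Z}
    (he : Function.Injective e) (Q : S → Y → Prop) :
    Nat.card {p : Z × Y // ∃ s, e s = p.1 ∧ Q s p.2} = ∑ s, Nat.card {y // Q s y} := by
  rw [← Nat.card_sigma]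
  refine (Nat.card_congr (Equiv.ofBijective
    (fun q : Σ s, {y // Q s y} => ⟨(e q.1, q.2.1), q.1, rfl, q.2.2⟩) ⟨?_, ?_⟩)).symm
  · rintro ⟨s, y, hy⟩ ⟨s', y', hy'⟩ h
    have h := congrArg Subtype.val h
    obtain rfl : s = s' := he (congrArg Prod.fst h)
    obtain rfl : y = y' := congrArg Prod.snd h
    rfl
  · rintro ⟨⟨z, y⟩, s, h, hy⟩
    exact ⟨⟨s, y, hy⟩, Subtype.ext (Prod.ext h rfl)⟩

theorem setOf_length_eq {α : Type} (m : ℕ) (V : Set (List α)) :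
    {y : List α | y.length = m ∧ y ∈ V} = List.ofFn '' {y : Fin m → α | List.ofFn y ∈ V} := by
  ext y
  constructor
  · rintro ⟨rfl, hy⟩
    exact ⟨y.get, by simpa using hy, by simp⟩
  · rintro ⟨y, hy, rfl⟩
    exact ⟨by simp, hy⟩

/-- The circuit accepts a tag of kind `i` with `k` strings if the first `i` are witnesses in
increasing order and the others are zero. For each of the `c i` tags this leaves as many choices as
there are `i`-element sets of witnesses. -/
theorem exists_circuits {R : Lang} (hR : R ∈ P) (s : Polynomial ℕ) (k : ℕ) (c : ℕ → ℕ) :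
    ∃ C : List Bool → Circuit, (fun x => (C x).encode) ∈ FP ∧ ∀ x, (C x).count =
      ∑ i : Fin (k + 1), c i *
        {y : List Bool | y.length = s.eval x.length ∧ pair x y ∈ R}.ncard.choose i := by
  classical
  obtain ⟨M, p, hp⟩ := exists_stackMachine hR
  obtain ⟨b, ⟨tag⟩⟩ := Finite.exists_equiv_fin (Σ i : Fin (k + 1), Fin (c i))
  -- Tags are one-hot strings, so the number of selector bits is the number of tags.
  let e : (Σ i : Fin (k + 1), Fin (c i)) → Fin b → Bool := fun q j => decide (tag q = j)
  have he : Function.Injective e := by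
    intro q q' h
    have := congrFun h (tag q)
    exact Eq.symm (by simpa [e] using this.symm)
  let acc : (Fin b → Bool) → ((Fin k → Fin k → Bool) × (Fin k → Bool)) → (Fin k → Bool) → Bool :=
    fun z q r => decide (∃ v, e v = z ∧ (∀ i : Fin k, (i : ℕ) < v.1 → r i = true) ∧
      (∀ i j : Fin k, i < j → (j : ℕ) < v.1 → q.1 i j = true) ∧
      ∀ i : Fin k, (v.1 : ℕ) ≤ i → q.2 i = true)
  let A := M.simulator k b (fun _ _ => false, fun _ => true) compareStep acc
  obtain ⟨D⟩ := A.nonempty_formulas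
  let ℓ : Polynomial ℕ := 2 * Polynomial.X + 2 + s
  have hℓ : ∀ n, ℓ.eval n = 2 * n + 2 + s.eval n := by simp [ℓ]
  -- The time for the runs, the time for the fold over the whole input, and the final step in which
  -- the head records the verdict.
  let T : Polynomial ℕ := p.comp ℓ + ℓ + 1
  refine ⟨D.circuit s T, D.encode_circuit_mem_FP s T, fun x => ?_⟩
  set m := s.eval x.length
  have hT : T.eval x.length = p.eval (2 * x.length + 2 + m) + (2 * x.length + 2 + m) + 1 := by
    simp [T, hℓ, m]
  let Q : (Σ i : Fin (k + 1), Fin (c i)) → (Fin k → Fin m → Bool) → Prop := fun v Y =>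
    (∀ i : Fin k, (i : ℕ) < v.1 → Y i ∈ {y | pair x (List.ofFn y) ∈ R}) ∧
      (∀ i j : Fin k, i < j → (j : ℕ) < v.1 → List.ofFn (Y i) < List.ofFn (Y j)) ∧
      ∀ i : Fin k, (v.1 : ℕ) ≤ i → Y i = fun _ => false
  have heval : ∀ X : Fin (b + m * k) → Bool, (D.circuit s T x).eval X = true ↔
      ∃ v, e v = (fun i : Fin b => (List.ofFn X).getD i false) ∧
        Q v fun i j => (List.ofFn X).getD (b + k * j + i) false := by
    intro X
    have hcol : ∀ i, (List.range m).map (fun j => (List.ofFn X).getD (b + k * j + i) false) =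
        List.ofFn fun j : Fin m => (List.ofFn X).getD (b + k * j + i) false := fun i =>
      List.ext_getElem (by simp) fun j _ _ => by simp
    have h1 := D.eval_circuit s T x X
    rw [hT] at h1
    have h2 := M.simulator_accepts (fun _ _ => false, fun _ => true) compareStep acc x m
      (fun i => (List.ofFn X).getD i false)
      (fun j i => (List.ofFn X).getD (b + k * j + i) false) hp (Nat.le_add_left _ _)
      (Nat.le_add_right _ _) (fun i => decide (pair x ((List.range m).map fun j =>
        (List.ofFn X).getD (b + k * j + i) false) ∈ R)) (fun i => decide_eq_true_iff)
    rw [h1.trans h2, decide_eq_true_iff]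
    obtain ⟨f1, f2⟩ := foldr_compareStep ((List.range m).map fun j (i : Fin k) =>
      (List.ofFn X).getD (b + k * j + i) false)
    simp only [f1, f2, List.map_map, Function.comp_def, hcol, decide_eq_true_iff]
    refine exists_congr fun v => and_congr_right fun _ => and_congr_right fun _ =>
      and_congr_right fun _ => forall_congr' fun i => imp_congr_right fun _ => ?_
    rw [funext_iff]
    simp [Fin.forall_iff]
  have hcount : (D.circuit s T x).count = Nat.card {X : Fin (b + m * k) → Bool //
      (D.circuit s T x).eval X = true} := by
    rw [Circuit.count, ← Fintype.card_subtype, ← Nat.card_eq_fintype_card]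
    rfl
  have hW : {y : List Bool | y.length = m ∧ pair x y ∈ R} =
    List.ofFn '' {y : Fin m → Bool | pair x (List.ofFn y) ∈ R} := setOf_length_eq m {y | pair x y ∈ R}
  have hQ : ∀ v, Nat.card {Y // Q v Y} =
      {y : List Bool | y.length = m ∧ pair x y ∈ R}.ncard.choose v.1 := fun v => by
    rw [hW, Set.ncard_image_of_injective _ List.ofFn_injective]
    exact card_increasing_tuples List.ofFn_injective _ _ (Nat.lt_succ_iff.1 v.1.2)
  rw [hcount, Nat.card_congr (Equiv.subtypeEquivRight heval),
    card_inputs fun z Y => ∃ v, e v = z ∧ Q v Y, card_exists_tag he Q]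
  simp only [hQ, Fintype.sum_sigma, Finset.sum_const, Finset.card_univ, Fintype.card_fin,
    smul_eq_mul]

end CircuitCounting

/-! ### Hardness of the counting problem -/

open CircuitCounting in
theorem corollary3 (A : Set ℕ) (hA : A.Nonempty) (hA' : A ≠ Set.univ) :
    CircuitCounting.Hard CircuitCounting.UPO1 (CircuitCounting.Counting A) ∧
      CircuitCounting.OneTTHard CircuitCounting.UPO1 (CircuitCounting.Counting A) := by
  suffices h : ∀ L ∈ UPO1, ∃ q ∈ FP, ∃ c : Bool, ∀ x, x ∈ L ↔ ((q x ∈ Counting A) ↔ c = true) by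
    refine ⟨fun L hL => ?_, fun L hL => ?_⟩ <;> obtain ⟨q, hq, c, h⟩ := h L hL
    · exact turingReduces_of_FP hq c h
    · exact oneTTReduces_of_FP hq c h
  rintro L ⟨f, ⟨k, R, hR, s, hf⟩, hL⟩
  -- `B` is whichever of `A` and its complement is infinite, `b` tells which, and `a` lies on the
  -- opposite side.
  obtain ⟨B, a, b, hB, ha, hb⟩ : ∃ (B : Set ℕ) (a : ℕ) (b : Bool), B.Infinite ∧
      ¬(a ∈ A ↔ b = true) ∧ ∀ n ∈ B, n ∈ A ↔ b = true := by
    by_cases h : A.Infinite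
    · obtain ⟨a, ha⟩ := (Set.ne_univ_iff_exists_notMem A).1 hA'
      exact ⟨A, a, true, h, by simpa using ha, fun n hn => by simpa using hn⟩
    · obtain ⟨a, ha⟩ := hA
      exact ⟨Aᶜ, a, false, (Set.not_infinite.1 h).infinite_compl, by simpa using ha,
        fun n hn => by simpa using hn⟩
  obtain ⟨c, h0, hc⟩ := exists_coefficients hB a k
  obtain ⟨C, hC, hcount⟩ := exists_circuits hR s k c
  refine ⟨_, hC, b, fun x => ?_⟩
  obtain ⟨hk, hx⟩ := hf x
  have hmem : (C x).encode ∈ Counting A ↔ (C x).count ∈ A :=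
    ⟨fun ⟨C', h, h'⟩ => Circuit.encode_injective h ▸ h', fun h => ⟨_, rfl, h⟩⟩
  rw [hL, hmem, hcount, hx, sum_fin_choose c hk]
  -- Without witnesses only the term `c 0 = a` remains, which is on the wrong side; otherwise the
  -- count lies in `B`.
  rcases Nat.eq_zero_or_pos (f x) with h | h
  · simpa [h, h0] using ha
  · exact iff_of_true h (hb _ (hc _ h hk))
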